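/- Let $k$ be a field, $R = k[x,y,z]$ with its standard grading, and $m = (x,y,z)$. Call an ideal $G \subset R$ Gorenstein if $R/G$ is a Gorenstein ring, and say that two proper homogeneous Cohen–Macaulay ideals $I, J \subset R$ (i.e. $R/I$ and $R/J$ are Cohen–Macaulay rings) are homogeneously G-linked if there is a homogeneous Gorenstein ideal $G$ with $G :_R I = J$ and $G :_R J = I$. An ideal $I$ is homogeneously glicci if there are ideals $I = I_0, I_1, \dots, I_l$ ($l \ge 0$) such that $I_i$ and $I_{i+1}$ are homogeneously G-linked for all $0 \le i < l$, and $I_l$ is a homogeneous complete intersection ideal (homogeneous and generated by a regular sequence). Let $I \subset R$ be an $m$-primary monomial ideal with $\mu(I) \le 7$, where $\mu(I)$ is the minimal number of generators of $I$. Then $I$ is homogeneously glicci, via a sequence of G-links with an $m$-primary monomial ideal in each second step: there are an integer $r \ge 0$ and ideals $I = I_0, I_1, \dots, I_{2r}$ such that $I_i$ and $I_{i+1}$ are homogeneously G-linked for all $0 \le i < 2r$, the ideal $I_{2r}$ is a homogeneous complete intersection ideal, and $I_{2j}$ is an $m$-primary monomial ideal for every $0 \le j \le r$. -/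

import Mathlib

/-- A commutative ring is Gorenstein if it is Noetherian and each of its localizations at a prime
has finite injective dimension as a module over itself. -/
def IsGorensteinRing (A : Type*) [CommRing A] : Prop :=
  IsNoetherianRing A ∧
    ∀ (p : Ideal A) [p.IsPrime], ∃ n : ℕ,
      CategoryTheory.HasInjectiveDimensionLT
        (ModuleCat.of (Localization.AtPrime p) (Localization.AtPrime p)) n

/-- A commutative ring is Cohen-Macaulay if it is Noetherian and each of its localizations at a
prime has depth equal to its Krull dimension, i.e. admits a regular sequence (necessarily in the
maximal ideal, since `IsRegular` asks that the quotient be nonzero) of length the dimension. -/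
def IsCohenMacaulayRing (A : Type*) [CommRing A] : Prop :=
  IsNoetherianRing A ∧
    ∀ (p : Ideal A) [p.IsPrime], ∃ rs : List (Localization.AtPrime p),
      RingTheory.Sequence.IsRegular (Localization.AtPrime p) rs ∧
        (rs.length : WithBot ℕ∞) = ringKrullDim (Localization.AtPrime p)

/-- A complete intersection ideal: an ideal generated by a regular sequence. -/
def IsCompleteIntersectionIdeal {A : Type*} [CommRing A] (I : Ideal A) : Prop :=
  ∃ rs : List A, RingTheory.Sequence.IsRegular A rs ∧ I = Ideal.ofList rs

namespace MvPolynomial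

attribute [local instance] MvPolynomial.gradedAlgebra

variable {σ k : Type*} [Field k]

/-- Homogeneous ideals of `k[x_i : i ∈ σ]` for the standard grading. -/
def IsHomogeneousIdeal (I : Ideal (MvPolynomial σ k)) : Prop :=
  I.IsHomogeneous (homogeneousSubmodule σ k)

/-- A monomial ideal: an ideal generated by a set of monomials. -/
def IsMonomialIdeal (I : Ideal (MvPolynomial σ k)) : Prop :=
  ∃ S : Set (σ →₀ ℕ), I = Ideal.span ((fun s => monomial s (1 : k)) '' S)

/-- `I` is `m`-primary, where `m` is the ideal generated by the variables. -/
def IsMPrimary (I : Ideal (MvPolynomial σ k)) : Prop :=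
  I.IsPrimary ∧ I.radical = idealOfVars σ k

/-- `I` and `J` are homogeneously G-linked by the ideal `G`: `I` and `J` are proper homogeneous
Cohen-Macaulay ideals, `G` is a homogeneous Gorenstein ideal, `G : I = J` and `G : J = I`. -/
structure IsHomogeneouslyGLinkedBy (G I J : Ideal (MvPolynomial σ k)) : Prop where
  left_ne_top : I ≠ ⊤
  right_ne_top : J ≠ ⊤
  left_cohenMacaulay : IsCohenMacaulayRing (MvPolynomial σ k ⧸ I)
  right_cohenMacaulay : IsCohenMacaulayRing (MvPolynomial σ k ⧸ J)
  left_homogeneous : IsHomogeneousIdeal I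
  right_homogeneous : IsHomogeneousIdeal J
  link_homogeneous : IsHomogeneousIdeal G
  link_gorenstein : IsGorensteinRing (MvPolynomial σ k ⧸ G)
  colon_left : G.colon (I : Set (MvPolynomial σ k)) = J
  colon_right : G.colon (J : Set (MvPolynomial σ k)) = I

/-- `J 0, J 1, …, J l` is a sequence of `l` homogeneous G-links that starts at `I` and ends at a
homogeneous complete intersection ideal. (The values `J i` with `l < i` play no role.) -/
structure IsGLinkSequenceToCI (I : Ideal (MvPolynomial σ k)) (l : ℕ)
    (J : ℕ → Ideal (MvPolynomial σ k)) : Prop where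
  start : J 0 = I
  link : ∀ i < l, ∃ G : Ideal (MvPolynomial σ k), IsHomogeneouslyGLinkedBy G (J i) (J (i + 1))
  last_homogeneous : IsHomogeneousIdeal (J l)
  last_completeIntersection : IsCompleteIntersectionIdeal (J l)

/-- `I` is homogeneously glicci: it lies in the homogeneous G-linkage class of a complete
intersection ideal. -/
def IsHomogeneouslyGlicci (I : Ideal (MvPolynomial σ k)) : Prop :=
  ∃ (l : ℕ) (J : ℕ → Ideal (MvPolynomial σ k)), IsGLinkSequenceToCI I l J

end MvPolynomial

/-! A linear functional `φ` concentrated in one degree has a homogeneous annihilator G =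
`functionalIdeal φ` with self-injective Artinian quotient (Macaulay duality), so every proper
homogeneous ideal that strictly contains G is linked by G to its colon ideal. If f is a form, G : f
≤ K and I = G + fK, then G : I = (G : f) : K, so I and K are two links apart
(`isDoublyGLinked_of_eq_sup`). For monomial I and K it remains to find suitable `φ` and f.

The heart is `IsMonomiallyGlicci.of_colon_variable`. Let the generators of U without y be x^(A+1),
z^(C+1) and one mixed x^(P+1) z^(T+1), and let V = U : y. Linking directly along y
(`isDoublyGLinked_lower`) needs a very large pure power of z, so it joins V not to U but to U₁,
which is U with z^(C+1) replaced by z^(T+1+N). The ideals U and U₁ agree in z-degrees up to C. A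
link along y^N + z^N (`isDoublyGLinked_raise`) takes U₁ to U₂, which is y^N U₁ in those z-degrees
and has a simple shape beyond. A monomial link (`isDoublyGLinked_shift`) joins U to U₃ = (x^(A+1),
z^(C+1)) + y^(N-1) U, and U₂ goes down to U₃ along y, again by `isDoublyGLinked_lower`. The chain is
U, U₃, U₂, U₁, V.

With at most eight generators, at most five are not pure powers, and each of these omits at most one
variable. So some variable is omitted by at most one of them, and dividing by it lowers the sum of
the degrees; the induction ends at pure powers. -/

/-! ### Cohen–Macaulay and Gorenstein rings whose elements are units or nilpotent -/

section LocalArtinian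

variable {A : Type*} [CommRing A]

theorem primeCompl_le_isUnit_of_isUnit_or_isNilpotent (hA : ∀ a : A, IsUnit a ∨ IsNilpotent a)
    (p : Ideal A) [p.IsPrime] : p.primeCompl ≤ IsUnit.submonoid A := by
  intro a ha
  rcases hA a with h | ⟨n, hn⟩
  · exact h
  · exact absurd (Ideal.IsPrime.mem_of_pow_mem ‹_› n (hn ▸ p.zero_mem)) ha

/-- If every element is a unit or nilpotent, localizing at a prime changes nothing. -/
noncomputable def equivLocalizationAtPrime (hA : ∀ a : A, IsUnit a ∨ IsNilpotent a)
    (p : Ideal A) [p.IsPrime] : A ≃ₐ[A] Localization.AtPrime p :=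
  IsLocalization.atUnits A p.primeCompl (primeCompl_le_isUnit_of_isUnit_or_isNilpotent hA p)

theorem krullDimLE_zero_of_isUnit_or_isNilpotent (hA : ∀ a : A, IsUnit a ∨ IsNilpotent a) :
    Ring.KrullDimLE 0 A := by
  refine .mk₀ fun p hp => ?_
  obtain ⟨q, hq, hpq⟩ := p.exists_le_maximal hp.ne_top
  suffices p = q from this ▸ hq
  refine le_antisymm hpq fun a ha => ?_
  by_contra hap
  exact hq.ne_top (q.eq_top_of_isUnit_mem ha
    (primeCompl_le_isUnit_of_isUnit_or_isNilpotent hA p hap))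

/-- Every localization is the ring itself, of dimension zero, so the empty regular sequence
suffices. -/
theorem isCohenMacaulayRing_of_isUnit_or_isNilpotent [IsNoetherianRing A]
    (hA : ∀ a : A, IsUnit a ∨ IsNilpotent a) : IsCohenMacaulayRing A := by
  refine ⟨inferInstance, fun p hp => ⟨[], RingTheory.Sequence.IsRegular.nil _ _, ?_⟩⟩
  have := krullDimLE_zero_of_isUnit_or_isNilpotent hA
  have hA' : Nontrivial A := (equivLocalizationAtPrime hA p).toRingEquiv.toEquiv.nontrivial
  rw [← ringKrullDim_eq_of_ringEquiv (equivLocalizationAtPrime hA p).toRingEquiv,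
    ringKrullDimZero_iff_ringKrullDim_eq_zero.mp this]
  rfl

theorem isGorensteinRing_of_injective [IsNoetherianRing A]
    (hA : ∀ a : A, IsUnit a ∨ IsNilpotent a) [Module.Injective A A] : IsGorensteinRing A := by
  -- The bound is strict: 1 stands for injective dimension at most zero.
  refine ⟨inferInstance, fun p hp => ⟨1, ?_⟩⟩
  let e := (equivLocalizationAtPrime hA p).toRingEquiv
  have : Module.Injective (Localization.AtPrime p) (Localization.AtPrime p) :=
    Module.Injective.of_ringEquiv e e.toSemilinearEquiv
  have := Module.injective_object_of_injective_module (Localization.AtPrime p)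
    (Localization.AtPrime p)
  exact CategoryTheory.injective_iff_hasInjectiveDimensionLT_one.mp this

end LocalArtinian

/-! ### Macaulay duality for a single functional -/

section InverseSystem

variable {k R : Type*} [Field k] [CommRing R] [Algebra k R]

/-- The largest ideal contained in the kernel of a linear functional. -/
def functionalIdeal (φ : R →ₗ[k] k) : Ideal R where
  carrier := {h | ∀ r, φ (r * h) = 0}
  add_mem' ha hb r := by simp [mul_add, ha r, hb r]
  zero_mem' r := by simp
  smul_mem' c h hh r := by simpa [mul_assoc] using hh (r * c)

theorem mem_functionalIdeal {φ : R →ₗ[k] k} {h : R} :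
    h ∈ functionalIdeal φ ↔ ∀ r, φ (r * h) = 0 := Iff.rfl

/-- The functional `h ↦ φ (f * h)`. -/
def contractFunctional (f : R) (φ : R →ₗ[k] k) : R →ₗ[k] k := φ ∘ₗ LinearMap.mulLeft k f

@[simp] theorem contractFunctional_apply (f h : R) (φ : R →ₗ[k] k) :
    contractFunctional f φ h = φ (f * h) := rfl

theorem mem_functionalIdeal_contractFunctional {φ : R →ₗ[k] k} {f h : R} :
    h ∈ functionalIdeal (contractFunctional f φ) ↔ f * h ∈ functionalIdeal φ := by
  simp only [mem_functionalIdeal, contractFunctional_apply, mul_left_comm]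

theorem apply_eq_zero_of_mem_functionalIdeal {φ : R →ₗ[k] k} {h : R}
    (hh : h ∈ functionalIdeal φ) : φ h = 0 := by simpa using hh 1

/-- A functional vanishing on an ideal descends to the quotient. -/
theorem exists_functional_quotient {I : Ideal R} (ψ : R →ₗ[k] k) (hψ : ∀ h ∈ I, ψ h = 0) :
    ∃ ψ' : (R ⧸ I) →ₗ[k] k, ∀ x, ψ' (Ideal.Quotient.mk I x) = ψ x := by
  obtain ⟨s, hs⟩ := (Ideal.Quotient.mkₐ k I).toLinearMap.exists_rightInverse_of_surjective
    (LinearMap.range_eq_top.mpr (Ideal.Quotient.mkₐ_surjective k I))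
  refine ⟨ψ ∘ₗ s, fun x => ?_⟩
  rw [LinearMap.comp_apply, ← sub_eq_zero, ← map_sub]
  refine hψ _ (Ideal.Quotient.eq.mp ?_)
  exact LinearMap.congr_fun hs (Ideal.Quotient.mk I x)

section Frobenius

variable {A : Type*} [CommRing A] [Algebra k A] [Module.Finite k A]

/-- Nondegeneracy embeds `A` into its dual by contraction of `φ`; the dimensions agree, so the
embedding is onto. -/
theorem exists_eq_contractFunctional_of_nondegenerate {φ : A →ₗ[k] k}
    (hφ : ∀ a, (∀ r, φ (r * a) = 0) → a = 0) (ψ : A →ₗ[k] k) :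
    ∃ c, ψ = contractFunctional c φ := by
  let g : A →ₗ[k] Module.Dual k A := (LinearMap.mul k A).compr₂ φ
  have hinj : Function.Injective g := by
    rw [injective_iff_map_eq_zero]
    intro c hc
    refine hφ c fun r => ?_
    rw [mul_comm]
    exact LinearMap.congr_fun hc r
  obtain ⟨c, hc⟩ := (LinearMap.injective_iff_surjective_of_finrank_eq_finrank
    (Subspace.dual_finrank_eq (K := k) (V := A)).symm).mp hinj ψ
  exact ⟨c, hc.symm⟩

/-- A finite-dimensional algebra with a nondegenerate functional is self-injective. -/
theorem injective_of_nondegenerate {φ : A →ₗ[k] k} (hφ : ∀ a, (∀ r, φ (r * a) = 0) → a = 0) :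
    Module.Injective A A := by
  refine Module.Baer.injective fun I g => ?_
  -- Baer's criterion: extend `φ ∘ g` linearly and represent the extension by `c`; multiplication by
  -- `c` then extends `g`.
  obtain ⟨ψ, hψ⟩ := LinearMap.exists_extend (p := I.restrictScalars k)
    (φ ∘ₗ (g.restrictScalars k))
  obtain ⟨c, rfl⟩ := exists_eq_contractFunctional_of_nondegenerate hφ ψ
  refine ⟨LinearMap.mulLeft _ c, fun x hx => ?_⟩
  rw [LinearMap.mulLeft_apply, ← sub_eq_zero]
  refine hφ _ fun r => ?_
  have h : φ (c * (r * x)) = φ (g (r • ⟨x, hx⟩)) := LinearMap.congr_fun hψ (r • ⟨x, hx⟩)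
  rw [map_smul, smul_eq_mul] at h
  rw [mul_sub, map_sub, ← h, sub_eq_zero, mul_left_comm]

end Frobenius

theorem exists_nondegenerate_quotient (φ : R →ₗ[k] k) :
    ∃ φ' : (R ⧸ functionalIdeal φ) →ₗ[k] k, (∀ x, φ' (Ideal.Quotient.mk _ x) = φ x) ∧
      ∀ a, (∀ r, φ' (r * a) = 0) → a = 0 := by
  obtain ⟨φ', hφ'⟩ := exists_functional_quotient φ
    fun h hh => apply_eq_zero_of_mem_functionalIdeal (φ := φ) hh
  refine ⟨φ', hφ', fun a ha => ?_⟩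
  obtain ⟨a, rfl⟩ := Ideal.Quotient.mk_surjective a
  refine Ideal.Quotient.eq_zero_iff_mem.mpr fun r => ?_
  rw [← hφ', map_mul]
  exact ha _

theorem exists_eq_contractFunctional {φ : R →ₗ[k] k} [Module.Finite k (R ⧸ functionalIdeal φ)]
    (ψ : R →ₗ[k] k) (hψ : ∀ h ∈ functionalIdeal φ, ψ h = 0) :
    ∃ c, ψ = contractFunctional c φ := by
  obtain ⟨φ', hφ', hnd⟩ := exists_nondegenerate_quotient φ
  obtain ⟨ψ', hψ'⟩ := exists_functional_quotient ψ hψ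
  obtain ⟨c, hc⟩ := exists_eq_contractFunctional_of_nondegenerate hnd ψ'
  obtain ⟨c, rfl⟩ := Ideal.Quotient.mk_surjective c
  refine ⟨c, LinearMap.ext fun h => ?_⟩
  rw [← hψ', hc, contractFunctional_apply, contractFunctional_apply, ← map_mul, hφ']

theorem injective_quotient_functionalIdeal (φ : R →ₗ[k] k)
    [Module.Finite k (R ⧸ functionalIdeal φ)] :
    Module.Injective (R ⧸ functionalIdeal φ) (R ⧸ functionalIdeal φ) := by
  obtain ⟨φ', -, hnd⟩ := exists_nondegenerate_quotient φ
  exact injective_of_nondegenerate hnd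

/-- Double annihilator property for the quotient by `functionalIdeal φ`. -/
theorem colon_colon_functionalIdeal (φ : R →ₗ[k] k) [Module.Finite k (R ⧸ functionalIdeal φ)]
    {I : Ideal R} (hI : functionalIdeal φ ≤ I) :
    (functionalIdeal φ).colon ((functionalIdeal φ).colon (I : Set R) : Set R) = I := by
  refine le_antisymm (fun h hh => ?_) fun h hh => ?_
  -- A functional that kills `I` but not `h` is a contraction of `φ` by some `c`; this `c` lies in
  -- the first colon, so `c * h` must be killed.
  · by_contra hhI
    obtain ⟨ψ, hψh, hψI⟩ :=
      Submodule.exists_le_ker_of_notMem (p := I.restrictScalars k) (v := h) hhI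
    obtain ⟨c, rfl⟩ := exists_eq_contractFunctional ψ fun g hg => hψI (hI hg)
    refine hψh ?_
    have hc : c ∈ (functionalIdeal φ).colon (I : Set R) := by
      refine Submodule.mem_colon.mpr fun i hi r => ?_
      have := hψI (show r * i ∈ I.restrictScalars k from I.mul_mem_left r hi)
      rw [LinearMap.mem_ker, contractFunctional_apply] at this
      rw [← this, smul_eq_mul, mul_left_comm]
    have := apply_eq_zero_of_mem_functionalIdeal (Submodule.mem_colon.mp hh c hc)
    rwa [smul_eq_mul, mul_comm] at this
  · refine Submodule.mem_colon.mpr fun c hc => ?_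
    have := Submodule.mem_colon.mp hc h hh
    rwa [smul_eq_mul, mul_comm] at this

end InverseSystem

namespace MvPolynomial

attribute [local instance] MvPolynomial.gradedAlgebra

section

variable {σ k : Type*} [Field k]

/-! ### Quotients by ideals containing a power of the irrelevant ideal -/

section FiniteColength

variable {I : Ideal (MvPolynomial σ k)} {N : ℕ}

theorem isUnit_or_isNilpotent_quotient (hI : idealOfVars σ k ^ N ≤ I)
    (a : MvPolynomial σ k ⧸ I) : IsUnit a ∨ IsNilpotent a := by
  obtain ⟨h, rfl⟩ := Ideal.Quotient.mk_surjective a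
  have h0 : h - C (coeff 0 h) ∈ idealOfVars σ k := by
    rw [← pow_one (idealOfVars σ k), mem_pow_idealOfVars_iff']
    intro x hx
    obtain rfl : x = 0 := (Finsupp.degree_eq_zero_iff x).mp (by lia)
    simp
  have hnil : IsNilpotent (Ideal.Quotient.mk I (h - C (coeff 0 h))) :=
    ⟨N, by rw [← map_pow]; exact Ideal.Quotient.eq_zero_iff_mem.mpr (hI (Ideal.pow_mem_pow h0 N))⟩
  have hh : h = (h - C (coeff 0 h)) + C (coeff 0 h) := by ring
  by_cases hc : coeff 0 h = 0
  · right
    rwa [hc, map_zero, sub_zero] at hnil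
  · left
    rw [hh, map_add]
    exact hnil.isUnit_add_right_of_commute
      (((isUnit_iff_ne_zero.mpr hc).map C).map (Ideal.Quotient.mk I)) (Commute.all _ _)

theorem isCohenMacaulayRing_quotient [Finite σ] (hI : idealOfVars σ k ^ N ≤ I) :
    IsCohenMacaulayRing (MvPolynomial σ k ⧸ I) :=
  isCohenMacaulayRing_of_isUnit_or_isNilpotent (isUnit_or_isNilpotent_quotient hI)

theorem finite_quotient [Finite σ] (hI : idealOfVars σ k ^ N ≤ I) :
    Module.Finite k (MvPolynomial σ k ⧸ I) := by
  have hfin : Set.Finite {s : σ →₀ ℕ | s.degree < N} := by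
    refine (Finsupp.finite_of_degree_le N).subset fun s hs => ?_
    exact (show s.degree < N from hs).le
  have : Finite {s : σ →₀ ℕ | s.degree < N} := hfin
  have : Module.Finite k (restrictSupport k {s : σ →₀ ℕ | s.degree < N}) :=
    Module.Finite.of_basis (basisRestrictSupport k _)
  refine Module.Finite.of_surjective ((Ideal.Quotient.mkₐ k I).toLinearMap ∘ₗ
    (restrictSupport k {s : σ →₀ ℕ | s.degree < N}).subtype) fun a => ?_
  obtain ⟨h, rfl⟩ := Ideal.Quotient.mk_surjective a
  refine ⟨⟨∑ s ∈ h.support with s.degree < N, monomial s (coeff s h), ?_⟩, ?_⟩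
  · refine Submodule.sum_mem _ fun s hs => ?_
    rw [monomial_mem_restrictSupport]
    exact Or.inl (Finset.mem_filter.mp hs).2
  · refine Ideal.Quotient.eq.mpr (hI ?_)
    rw [mem_pow_idealOfVars_iff']
    intro x hx
    classical
    simp only [Submodule.subtype_apply, coeff_sub, coeff_sum, coeff_monomial, Finset.sum_ite_eq',
      Finset.mem_filter, hx, and_true, mem_support_iff]
    by_cases h : coeff x h = 0 <;> simp [h]

end FiniteColength

/-! ### Functionals of a single degree and the links they give -/

section HomogeneousFunctional

/-- A functional concentrated in a single degree. -/
def IsHomogeneousFunctional (φ : MvPolynomial σ k →ₗ[k] k) : Prop :=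
  ∃ D, ∀ s : σ →₀ ℕ, s.degree ≠ D → φ (monomial s 1) = 0

variable {φ : MvPolynomial σ k →ₗ[k] k}

theorem apply_eq_zero_of_degree_ne {D : ℕ} (hφ : ∀ s : σ →₀ ℕ, s.degree ≠ D → φ (monomial s 1) = 0)
    {h : MvPolynomial σ k} (hh : ∀ s ∈ h.support, s.degree ≠ D) : φ h = 0 := by
  rw [h.as_sum, map_sum]
  refine Finset.sum_eq_zero fun s hs => ?_
  rw [← mul_one (coeff s h), ← smul_eq_mul, ← smul_monomial, map_smul, hφ s (hh s hs), smul_zero]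

theorem mem_functionalIdeal_iff_monomial {h : MvPolynomial σ k} :
    h ∈ functionalIdeal φ ↔ ∀ s, φ (monomial s 1 * h) = 0 := by
  refine ⟨fun hh s => hh _, fun hh r => ?_⟩
  rw [r.as_sum, Finset.sum_mul, map_sum]
  refine Finset.sum_eq_zero fun s _ => ?_
  rw [show monomial s (coeff s r) = coeff s r • monomial s (1 : k) by
    rw [smul_monomial, smul_eq_mul, mul_one], smul_mul_assoc, map_smul, hh s, smul_zero]

theorem IsHomogeneousFunctional.pow_le (hφ : IsHomogeneousFunctional φ) :
    ∃ N, idealOfVars σ k ^ N ≤ functionalIdeal φ := by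
  obtain ⟨D, hD⟩ := hφ
  refine ⟨D + 1, fun h hh r => apply_eq_zero_of_degree_ne hD fun s hs => ?_⟩
  have := (mem_pow_idealOfVars_iff _ _).mp (Ideal.mul_mem_left _ r hh) s hs
  lia

theorem degree_of_mem_support_mul {f h : MvPolynomial σ k} {d e : ℕ} (hf : f.IsHomogeneous d)
    (hh : h.IsHomogeneous e) {s : σ →₀ ℕ} (hs : s ∈ (f * h).support) : s.degree = d + e := by
  rw [Finsupp.degree_eq_weight_one]
  exact (hf.mul hh) (mem_support_iff.mp hs)

theorem IsHomogeneousFunctional.contract (hφ : IsHomogeneousFunctional φ) {f : MvPolynomial σ k}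
    {d : ℕ} (hf : f.IsHomogeneous d) : IsHomogeneousFunctional (contractFunctional f φ) := by
  obtain ⟨D, hD⟩ := hφ
  -- For `d > D` the truncated difference does no harm: the contraction is zero.
  refine ⟨D - d, fun s hs => ?_⟩
  by_cases hd : d ≤ D
  · refine apply_eq_zero_of_degree_ne hD fun t ht => ?_
    rw [degree_of_mem_support_mul hf (isHomogeneous_monomial 1 rfl) ht]
    lia
  · refine apply_eq_zero_of_degree_ne hD fun t ht => ?_
    rw [degree_of_mem_support_mul hf (isHomogeneous_monomial 1 rfl) ht]
    lia

theorem IsHomogeneousFunctional.isHomogeneousIdeal (hφ : IsHomogeneousFunctional φ) :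
    IsHomogeneousIdeal (functionalIdeal φ) := by
  obtain ⟨D, hD⟩ := hφ
  intro n h hh
  rw [show (DirectSum.decompose (homogeneousSubmodule σ k) h n : MvPolynomial σ k) =
    homogeneousComponent n h from decomposition.decompose'_apply h n,
    mem_functionalIdeal_iff_monomial]
  intro s
  -- In the complementary degree `φ` cannot tell `h` from its component; in any other degree it
  -- kills the product.
  by_cases hn : s.degree + n = D
  · rw [← hh (monomial s 1), ← sub_eq_zero, ← map_sub, ← mul_sub]
    refine apply_eq_zero_of_degree_ne hD fun t ht => ?_
    classical
    rw [mem_support_iff, coeff_monomial_mul', ] at ht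
    split_ifs at ht with hst
    · rw [one_mul, coeff_sub, coeff_homogeneousComponent] at ht
      have h1 : t.degree = s.degree + (t - s).degree := by
        conv_lhs => rw [← add_tsub_cancel_of_le hst, map_add]
      split_ifs at ht with h2
      · simp at ht
      · lia
    · simp at ht
  · refine apply_eq_zero_of_degree_ne hD fun t ht => ?_
    rwa [degree_of_mem_support_mul (isHomogeneous_monomial 1 rfl)
      (homogeneousComponent_isHomogeneous n h) ht]

theorem isHomogeneousIdeal_colon {G I : Ideal (MvPolynomial σ k)} (hG : IsHomogeneousIdeal G)
    (hI : IsHomogeneousIdeal I) : IsHomogeneousIdeal (G.colon (I : Set (MvPolynomial σ k))) := by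
  intro n h hh
  refine Submodule.mem_colon.mpr fun i hi => ?_
  classical
  rw [← DirectSum.sum_support_decompose (homogeneousSubmodule σ k) i, smul_eq_mul, Finset.mul_sum]
  refine Ideal.sum_mem _ fun d _ => ?_
  rw [← DirectSum.coe_decompose_mul_add_of_right_mem (homogeneousSubmodule σ k)
    (SetLike.coe_mem (DirectSum.decompose (homogeneousSubmodule σ k) i d))]
  exact hG _ (Submodule.mem_colon.mp hh _ (hI d hi))

theorem IsHomogeneousFunctional.isGorensteinRing [Finite σ] (hφ : IsHomogeneousFunctional φ) :
    IsGorensteinRing (MvPolynomial σ k ⧸ functionalIdeal φ) := by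
  obtain ⟨N, hN⟩ := hφ.pow_le
  have := finite_quotient hN
  have := injective_quotient_functionalIdeal φ
  exact isGorensteinRing_of_injective (isUnit_or_isNilpotent_quotient hN)

/-- An ideal containing the homogeneous Gorenstein ideal of `φ` is linked to its colon ideal. -/
theorem IsHomogeneousFunctional.isHomogeneouslyGLinkedBy [Finite σ]
    (hφ : IsHomogeneousFunctional φ) {I : Ideal (MvPolynomial σ k)} (hI : IsHomogeneousIdeal I)
    (htop : I ≠ ⊤) (hle : functionalIdeal φ ≤ I) (hne : ¬ I ≤ functionalIdeal φ) :
    IsHomogeneouslyGLinkedBy (functionalIdeal φ) I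
      ((functionalIdeal φ).colon (I : Set (MvPolynomial σ k))) := by
  obtain ⟨N, hN⟩ := hφ.pow_le
  have := finite_quotient hN
  refine ⟨htop, fun h => hne fun i hi => ?_, isCohenMacaulayRing_quotient (hN.trans hle),
    isCohenMacaulayRing_quotient (N := N) (hN.trans fun h hh => ?_), hI,
    isHomogeneousIdeal_colon hφ.isHomogeneousIdeal hI, hφ.isHomogeneousIdeal,
    hφ.isGorensteinRing, rfl, colon_colon_functionalIdeal φ hle⟩
  · have := Submodule.mem_colon.mp (h ▸ Submodule.mem_top : (1 : MvPolynomial σ k) ∈ _) i hi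
    rwa [one_smul] at this
  · exact Submodule.mem_colon.mpr fun i _ => Ideal.mul_mem_right _ _ hh

end HomogeneousFunctional

theorem IsHomogeneouslyGLinkedBy.symm {G I J : Ideal (MvPolynomial σ k)}
    (h : IsHomogeneouslyGLinkedBy G I J) : IsHomogeneouslyGLinkedBy G J I :=
  ⟨h.right_ne_top, h.left_ne_top, h.right_cohenMacaulay, h.left_cohenMacaulay,
    h.right_homogeneous, h.left_homogeneous, h.link_homogeneous, h.link_gorenstein,
    h.colon_right, h.colon_left⟩

/-- `I` and `K` are connected by two homogeneous G-links. -/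
def IsDoublyGLinked (I K : Ideal (MvPolynomial σ k)) : Prop :=
  ∃ J, (∃ G, IsHomogeneouslyGLinkedBy G I J) ∧ ∃ G, IsHomogeneouslyGLinkedBy G J K

theorem IsDoublyGLinked.symm {I K : Ideal (MvPolynomial σ k)} (h : IsDoublyGLinked I K) :
    IsDoublyGLinked K I := by
  obtain ⟨J, ⟨G, hG⟩, G', hG'⟩ := h
  exact ⟨J, ⟨G', hG'.symm⟩, G, hG.symm⟩

/-- If `G` is the Gorenstein ideal of `φ` and `G : f ≤ K`, then `G + f K` and `K` are connected by
two links, the first one by `G` and the second one by `G : f`. -/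
theorem isDoublyGLinked_of_eq_sup [Finite σ] {φ : MvPolynomial σ k →ₗ[k] k}
    (hφ : IsHomogeneousFunctional φ) {f : MvPolynomial σ k} {d : ℕ} (hf : f.IsHomogeneous d)
    {I K : Ideal (MvPolynomial σ k)} (hI : IsHomogeneousIdeal I) (hK : IsHomogeneousIdeal K)
    (hItop : I ≠ ⊤) (hKtop : K ≠ ⊤) (hGI : functionalIdeal φ ≤ I)
    (hIG : ∀ h ∈ I, h ∈ functionalIdeal φ ⊔ Ideal.span {f} * K)
    (hfK : ∀ h ∈ K, f * h ∈ I) (hGK : functionalIdeal (contractFunctional f φ) ≤ K)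
    (hne : ∃ h ∈ K, f * h ∉ functionalIdeal φ) : IsDoublyGLinked I K := by
  obtain ⟨h₀, h₀K, h₀G⟩ := hne
  have hcolon : (functionalIdeal φ).colon (I : Set (MvPolynomial σ k)) =
      (functionalIdeal (contractFunctional f φ)).colon (K : Set (MvPolynomial σ k)) := by
    ext g
    simp only [Submodule.mem_colon, SetLike.mem_coe, smul_eq_mul,
      mem_functionalIdeal_contractFunctional]
    refine ⟨fun hg h hh => ?_, fun hg i hi => ?_⟩
    · rw [mul_left_comm]
      exact hg _ (hfK h hh)
    · obtain ⟨a, ha, b, hb, rfl⟩ := Submodule.mem_sup.mp (hIG i hi)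
      obtain ⟨h, hh, rfl⟩ := Ideal.mem_span_singleton_mul.mp hb
      rw [mul_add, mul_left_comm]
      exact add_mem (Ideal.mul_mem_left _ _ ha) (hg h hh)
  refine ⟨_, ⟨_, hφ.isHomogeneouslyGLinkedBy hI hItop hGI fun h => h₀G (h (hfK _ h₀K))⟩,
    functionalIdeal (contractFunctional f φ), ?_⟩
  rw [hcolon]
  exact ((hφ.contract hf).isHomogeneouslyGLinkedBy hK hKtop hGK fun h =>
    h₀G (mem_functionalIdeal_contractFunctional.mp (h h₀K))).symm

end

/-! ### Monomial ideals as upper sets of exponents -/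

section MonomialIdeal

variable {σ : Type*} (k : Type*) [Field k]

/-- The ideal spanned by the monomials with exponent in an upper set. -/
noncomputable def monomialIdeal (U : UpperSet (σ →₀ ℕ)) : Ideal (MvPolynomial σ k) :=
  restrictSupportIdeal k U U.upper

variable {k} {U : UpperSet (σ →₀ ℕ)}

theorem mem_monomialIdeal {h : MvPolynomial σ k} :
    h ∈ monomialIdeal k U ↔ ∀ s ∈ h.support, s ∈ U := Iff.rfl

theorem monomial_mem_monomialIdeal {s : σ →₀ ℕ} :
    monomial s (1 : k) ∈ monomialIdeal k U ↔ s ∈ U := by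
  classical
  simp [mem_monomialIdeal, support_monomial]

theorem mem_of_forall_monomial_mem {J : Ideal (MvPolynomial σ k)}
    (hJ : ∀ s ∈ U, monomial s (1 : k) ∈ J) {h : MvPolynomial σ k} (hh : h ∈ monomialIdeal k U) :
    h ∈ J := by
  rw [h.as_sum]
  refine Ideal.sum_mem _ fun s hs => ?_
  rw [← mul_one (coeff s h), ← C_mul_monomial]
  exact Ideal.mul_mem_left _ _ (hJ s (hh hs))

theorem monomialIdeal_eq_span :
    monomialIdeal k U = Ideal.span ((fun s => monomial s (1 : k)) '' U) := by
  have hle : ∀ s ∈ U, monomial s (1 : k) ∈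
      Ideal.span ((fun s => monomial s (1 : k)) '' (U : Set (σ →₀ ℕ))) :=
    fun s hs => Ideal.subset_span ⟨s, hs, rfl⟩
  refine le_antisymm (fun h hh => mem_of_forall_monomial_mem hle hh) (Ideal.span_le.mpr ?_)
  · rintro _ ⟨s, hs, rfl⟩
    exact monomial_mem_monomialIdeal.mpr hs

theorem isMonomialIdeal_monomialIdeal : IsMonomialIdeal (monomialIdeal k U) :=
  ⟨U, monomialIdeal_eq_span⟩

theorem isHomogeneousIdeal_monomialIdeal : IsHomogeneousIdeal (monomialIdeal k U) := by
  unfold IsHomogeneousIdeal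
  rw [monomialIdeal_eq_span]
  refine Ideal.homogeneous_span _ _ ?_
  rintro _ ⟨s, -, rfl⟩
  exact ⟨s.degree, isHomogeneous_monomial 1 rfl⟩

theorem monomialIdeal_ne_top_iff : monomialIdeal k U ≠ ⊤ ↔ (0 : σ →₀ ℕ) ∉ U := by
  rw [Ne, Ideal.eq_top_iff_one, not_iff_not]
  exact monomial_mem_monomialIdeal

/-- Coefficient functionals outside `U` cut out the monomial ideal, so it is enough that each of
them is a contraction of `φ`. -/
theorem le_monomialIdeal_of_forall_coeff {φ : MvPolynomial σ k →ₗ[k] k}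
    (hφ : ∀ s ∉ U, ∃ c, ∀ h, φ (c * h) = coeff s h) : functionalIdeal φ ≤ monomialIdeal k U := by
  refine fun h hh => mem_monomialIdeal.mpr fun s hs => ?_
  by_contra hsU
  obtain ⟨c, hc⟩ := hφ s hsU
  exact mem_support_iff.mp hs (by rw [← hc, hh])

/-- `isDoublyGLinked_of_eq_sup` for monomial ideals. -/
theorem isDoublyGLinked_monomialIdeal [Finite σ] {φ : MvPolynomial σ k →ₗ[k] k}
    (hφ : IsHomogeneousFunctional φ) {f : MvPolynomial σ k} {d : ℕ} (hf : f.IsHomogeneous d)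
    {U V : UpperSet (σ →₀ ℕ)} (hU : (0 : σ →₀ ℕ) ∉ U) (hV : (0 : σ →₀ ℕ) ∉ V)
    (hφU : ∀ s ∉ U, ∃ c, ∀ h, φ (c * h) = coeff s h)
    (hφV : ∀ s ∉ V, ∃ c, ∀ h, φ (c * (f * h)) = coeff s h)
    (hUV : ∀ s ∈ U, monomial s (1 : k) ∈ functionalIdeal φ ⊔ Ideal.span {f} * monomialIdeal k V)
    (hVU : ∀ s ∈ V, f * monomial s 1 ∈ monomialIdeal k U)
    (hne : ∃ s ∈ V, ∃ c, φ (c * (f * monomial s 1)) ≠ 0) :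
    IsDoublyGLinked (monomialIdeal k U) (monomialIdeal k V) := by
  refine isDoublyGLinked_of_eq_sup hφ hf isHomogeneousIdeal_monomialIdeal
    isHomogeneousIdeal_monomialIdeal (monomialIdeal_ne_top_iff.mpr hU)
    (monomialIdeal_ne_top_iff.mpr hV) (le_monomialIdeal_of_forall_coeff hφU)
    (fun h hh => mem_of_forall_monomial_mem hUV hh) (fun h hh => ?_)
    (le_monomialIdeal_of_forall_coeff fun s hs => ?_) ?_
  · exact mem_of_forall_monomial_mem (U := V)
      (J := Submodule.comap (LinearMap.mulLeft (MvPolynomial σ k) f) (monomialIdeal k U)) hVU hh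
  · obtain ⟨c, hc⟩ := hφV s hs
    refine ⟨c, fun h => ?_⟩
    rw [← hc, contractFunctional_apply, mul_left_comm]
  · obtain ⟨s, hs, c, hc⟩ := hne
    exact ⟨_, monomial_mem_monomialIdeal.mpr hs, fun h => hc (h c)⟩

end MonomialIdeal

/-! ### Three variables in permuted order, and monomial links -/

section Triple

variable {k : Type*} [Field k]

/-- The exponent with coordinates `a, b, c` in the order given by `e`. -/
noncomputable def triple (e : Equiv.Perm (Fin 3)) (a b c : ℕ) : Fin 3 →₀ ℕ :=
  Finsupp.single (e 0) a + Finsupp.single (e 1) b + Finsupp.single (e 2) c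

variable {e : Equiv.Perm (Fin 3)} {a b c a' b' c' : ℕ}

@[simp] theorem triple_apply_zero : triple e a b c (e 0) = a := by simp [triple]

@[simp] theorem triple_apply_one : triple e a b c (e 1) = b := by simp [triple]

@[simp] theorem triple_apply_two : triple e a b c (e 2) = c := by simp [triple]

theorem forall_fin_three_perm (e : Equiv.Perm (Fin 3)) {p : Fin 3 → Prop} :
    (∀ v, p v) ↔ p (e 0) ∧ p (e 1) ∧ p (e 2) := by
  rw [← e.forall_congr_right, Fin.forall_fin_succ, Fin.forall_fin_succ, Fin.forall_fin_succ]
  simp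

theorem triple_eta (s : Fin 3 →₀ ℕ) : triple e (s (e 0)) (s (e 1)) (s (e 2)) = s := by
  refine Finsupp.ext ?_
  rw [forall_fin_three_perm e]
  simp

theorem forall_triple (e : Equiv.Perm (Fin 3)) {p : (Fin 3 →₀ ℕ) → Prop} :
    (∀ s, p s) ↔ ∀ a b c, p (triple e a b c) :=
  ⟨fun h _ _ _ => h _, fun h s => triple_eta (e := e) s ▸ h _ _ _⟩

@[simp] theorem triple_zero : triple e 0 0 0 = 0 := by simp [triple]

@[simp] theorem triple_le_triple :
    triple e a b c ≤ triple e a' b' c' ↔ a ≤ a' ∧ b ≤ b' ∧ c ≤ c' := by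
  rw [Finsupp.le_def, forall_fin_three_perm e]
  simp

@[simp] theorem triple_inj :
    triple e a b c = triple e a' b' c' ↔ a = a' ∧ b = b' ∧ c = c' := by
  rw [Finsupp.ext_iff, forall_fin_three_perm e]
  simp

@[simp] theorem triple_add :
    triple e a b c + triple e a' b' c' = triple e (a + a') (b + b') (c + c') := by
  refine Finsupp.ext ?_
  rw [forall_fin_three_perm e]
  simp

@[simp] theorem triple_tsub :
    triple e a b c - triple e a' b' c' = triple e (a - a') (b - b') (c - c') := by
  refine Finsupp.ext ?_
  rw [forall_fin_three_perm e]
  simp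

@[simp] theorem degree_triple : (triple e a b c).degree = a + b + c := by simp [triple]

variable (k e) in
/-- The functional reading off the coefficient of `triple e a b c`. -/
noncomputable def coeffTriple (a b c : ℕ) : MvPolynomial (Fin 3) k →ₗ[k] k :=
  lcoeff k (triple e a b c)

variable (k e) in
/-- The monomial with exponent `triple e a b c`. -/
noncomputable def monomialTriple (a b c : ℕ) : MvPolynomial (Fin 3) k :=
  monomial (triple e a b c) 1

theorem coeffTriple_apply (h : MvPolynomial (Fin 3) k) :
    coeffTriple k e a b c h = coeff (triple e a b c) h := rfl

@[simp] theorem coeffTriple_monomialTriple_mul (h : MvPolynomial (Fin 3) k) :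
    coeffTriple k e a b c (monomialTriple k e a' b' c' * h) =
      if a' ≤ a ∧ b' ≤ b ∧ c' ≤ c then coeffTriple k e (a - a') (b - b') (c - c') h else 0 := by
  simp [coeffTriple_apply, monomialTriple, coeff_monomial_mul']

@[simp] theorem coeffTriple_monomialTriple :
    coeffTriple k e a b c (monomialTriple k e a' b' c') =
      if a' = a ∧ b' = b ∧ c' = c then 1 else 0 := by
  classical
  simp [coeffTriple_apply, monomialTriple, coeff_monomial]

theorem monomialTriple_mul_monomialTriple :
    monomialTriple k e a b c * monomialTriple k e a' b' c' =
      monomialTriple k e (a + a') (b + b') (c + c') := by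
  simp [monomialTriple]

theorem isHomogeneous_monomialTriple :
    (monomialTriple k e a b c).IsHomogeneous (a + b + c) :=
  isHomogeneous_monomial 1 degree_triple

theorem coeffTriple_monomial_of_degree_ne {s : Fin 3 →₀ ℕ} (hs : s.degree ≠ a + b + c) :
    coeffTriple k e a b c (monomial s 1) = 0 := by
  classical
  rw [coeffTriple_apply, coeff_monomial, if_neg]
  rintro rfl
  exact hs degree_triple

theorem mem_functionalIdeal_iff_monomialTriple (e : Equiv.Perm (Fin 3))
    {φ : MvPolynomial (Fin 3) k →ₗ[k] k} {h : MvPolynomial (Fin 3) k} :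
    h ∈ functionalIdeal φ ↔ ∀ a b c, φ (monomialTriple k e a b c * h) = 0 := by
  rw [mem_functionalIdeal_iff_monomial, forall_triple e]
  rfl

theorem mem_of_triple_le {U : UpperSet (Fin 3 →₀ ℕ)} (h : triple e a b c ∈ U) (ha : a ≤ a')
    (hb : b ≤ b') (hc : c ≤ c') : triple e a' b' c' ∈ U :=
  U.upper (triple_le_triple.mpr ⟨ha, hb, hc⟩) h

theorem monomialTriple_mem_monomialIdeal {U : UpperSet (Fin 3 →₀ ℕ)} :
    monomialTriple k e a b c ∈ monomialIdeal k U ↔ triple e a b c ∈ U :=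
  monomial_mem_monomialIdeal

/-- `isDoublyGLinked_monomialIdeal` in coordinates. -/
theorem isDoublyGLinked_triple (e : Equiv.Perm (Fin 3)) {φ : MvPolynomial (Fin 3) k →ₗ[k] k}
    (hφ : IsHomogeneousFunctional φ) {f : MvPolynomial (Fin 3) k} {d : ℕ} (hf : f.IsHomogeneous d)
    {U V : UpperSet (Fin 3 →₀ ℕ)} (hU : (0 : Fin 3 →₀ ℕ) ∉ U) (hV : (0 : Fin 3 →₀ ℕ) ∉ V)
    (hφU : ∀ a b c, triple e a b c ∉ U → ∃ g, ∀ h, φ (g * h) = coeffTriple k e a b c h)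
    (hφV : ∀ a b c, triple e a b c ∉ V → ∃ g, ∀ h, φ (g * (f * h)) = coeffTriple k e a b c h)
    (hUV : ∀ a b c, triple e a b c ∈ U →
      monomialTriple k e a b c ∈ functionalIdeal φ ⊔ Ideal.span {f} * monomialIdeal k V)
    (hVU : ∀ a b c, triple e a b c ∈ V → f * monomialTriple k e a b c ∈ monomialIdeal k U)
    (hne : ∃ a b c, triple e a b c ∈ V ∧ ∃ g, φ (g * (f * monomialTriple k e a b c)) ≠ 0) :
    IsDoublyGLinked (monomialIdeal k U) (monomialIdeal k V) := by
  obtain ⟨a, b, c, habc, hne⟩ := hne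
  exact isDoublyGLinked_monomialIdeal hφ hf hU hV ((forall_triple e).mpr hφU)
    ((forall_triple e).mpr hφV) ((forall_triple e).mpr hUV) ((forall_triple e).mpr hVU)
    ⟨_, habc, hne⟩

/-- Dividing by a power of a variable: a double link by monomial complete intersections. -/
theorem isDoublyGLinked_shift {U V : UpperSet (Fin 3 →₀ ℕ)} {A B C d : ℕ}
    (hU : ∀ a b c, triple e a b c ∈ U ↔
      A < a ∨ C < c ∨ d ≤ b ∧ triple e a (b - d) c ∈ V)
    (hV : (0 : Fin 3 →₀ ℕ) ∉ V) (hA : triple e (A + 1) 0 0 ∈ V) (hB : triple e 0 B 0 ∈ V)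
    (hC : triple e 0 0 (C + 1) ∈ V) :
    IsDoublyGLinked (monomialIdeal k U) (monomialIdeal k V) := by
  have hU0 : (0 : Fin 3 →₀ ℕ) ∉ U := by
    rw [← triple_zero (e := e), hU]
    simpa using fun _ => hV
  have hrep : ∀ a b c, triple e a b c ∉ U →
      ∀ h, coeffTriple k e A (B + d) C (monomialTriple k e (A - a) (B + d - b) (C - c) * h) =
        coeffTriple k e a b c h := by
    intro a b c habc h
    rw [hU] at habc
    push Not at habc
    have hb : b ≤ B + d := by
      by_contra hb
      exact habc.2.2 (by lia) (mem_of_triple_le hB (by lia) (by lia) (by lia))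
    rw [coeffTriple_monomialTriple_mul, if_pos (by lia)]
    congr 2 <;> lia
  -- Here G = (x^(A+1), y^(B+d+1), z^(C+1)) and f = y^d. Since y^B, not just y^(B+1), is in `V`, the
  -- product f y^B = y^(B+d) is outside G.
  refine isDoublyGLinked_triple e (φ := coeffTriple k e A (B + d) C)
    ⟨_, fun s hs => coeffTriple_monomial_of_degree_ne hs⟩
    (isHomogeneous_monomialTriple (a := 0) (b := d) (c := 0) (e := e)) hU0 hV
    (fun a b c habc => ⟨_, hrep a b c habc⟩) (fun a b c habc => ?_) (fun a b c habc => ?_)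
    (fun a b c habc => ?_) ⟨0, B, 0, hB, monomialTriple k e A 0 C, ?_⟩
  · have habc' : triple e a (b + d) c ∉ U := by
      rw [hU]
      rintro (h | h | h)
      · exact habc (mem_of_triple_le hA (by lia) (by lia) (by lia))
      · exact habc (mem_of_triple_le hC (by lia) (by lia) (by lia))
      · exact habc (by simpa using h.2)
    exact ⟨_, fun h => by rw [hrep _ _ _ habc']; simp⟩
  · rw [hU] at habc
    by_cases hac : A < a ∨ C < c
    · refine Ideal.mem_sup_left ((mem_functionalIdeal_iff_monomialTriple e).mpr fun a' b' c' => ?_)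
      rw [monomialTriple_mul_monomialTriple, coeffTriple_monomialTriple, if_neg (by lia)]
    · obtain ⟨hb, hab⟩ : d ≤ b ∧ triple e a (b - d) c ∈ V := by tauto
      refine Ideal.mem_sup_right (Ideal.mem_span_singleton_mul.mpr
        ⟨_, monomialTriple_mem_monomialIdeal.mpr hab, ?_⟩)
      rw [monomialTriple_mul_monomialTriple]
      congr 1 <;> lia
  · rw [monomialTriple_mul_monomialTriple, monomialTriple_mem_monomialIdeal, hU]
    exact Or.inr (Or.inr ⟨by lia, by simpa using habc⟩)
  · simp [monomialTriple_mul_monomialTriple, add_comm]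

end Triple

/-! ### Double links by non-monomial Gorenstein ideals -/

section

variable {k : Type*} [Field k] {e : Equiv.Perm (Fin 3)}

/-- A double link along `y ^ n + z ^ n`, which raises the order of `U` by `y ^ n` outside the
component `(x ^ (P + 1), y)` and by `z ^ n` along it. -/
theorem isDoublyGLinked_raise {U V : UpperSet (Fin 3 →₀ ℕ)} {A B C P T n : ℕ}
    (hU : ∀ a b c, triple e a b c ∈ U ↔
      A < a ∨ (T < c ∧ (P < a ∨ 0 < b ∨ C + n ≤ c)) ∨ n ≤ b ∧ triple e a (b - n) c ∈ V)
    (hV : (0 : Fin 3 →₀ ℕ) ∉ V) (hA : triple e (A + 1) 0 0 ∈ V) (hB : triple e 0 B 0 ∈ V)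
    (hC : triple e 0 0 C ∈ V) (hxz : triple e (P + 1) 0 (T + 1) ∈ V)
    (hyz : triple e 0 1 (T + 1) ∈ V)
    (hVle : ∀ a b c, triple e a b c ∈ V → P < a ∨ 0 < b ∨ C ≤ c)
    (hPA : P ≤ A) (hTC : T < C) (hTn : T < n) :
    IsDoublyGLinked (monomialIdeal k U) (monomialIdeal k V) := by
  -- The two terms of the functional must have equal degree and socle exponents beyond everything in
  -- use.
  obtain ⟨E, F, hEF, hE, hF⟩ : ∃ E F, P + 0 + F = A + E + T ∧ B + n + 1 ≤ E ∧ T + 1 + C + n ≤ F :=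
    ⟨P + (A + 2 * T + C + 2 * n + B + 5) - A - T, A + 2 * T + C + 2 * n + B + 5,
      by lia, by lia, by lia⟩
  have hU0 : (0 : Fin 3 →₀ ℕ) ∉ U := by
    rw [← triple_zero (e := e), hU]
    simp only [triple_zero, zero_tsub, hV, and_false, or_false]
    lia
  have hf : (monomialTriple k e 0 n 0 + monomialTriple k e 0 0 n).IsHomogeneous n := by
    refine (homogeneousSubmodule (Fin 3) k n).add_mem ?_ ?_
    · simpa using isHomogeneous_monomialTriple (k := k) (e := e) (a := 0) (b := n) (c := 0)
    · simpa using isHomogeneous_monomialTriple (k := k) (e := e) (a := 0) (b := 0) (c := n)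
  -- Its annihilator contains (x^(A+1), z^(T+1)) ∩ (x^(P+1), y). As n > T, the form y^n + z^n acts
  -- as y^n on the first component and as z^n on the second.
  have hφ : IsHomogeneousFunctional (coeffTriple k e A E T - coeffTriple k e P 0 F) :=
    ⟨A + E + T, fun s hs => by
      rw [LinearMap.sub_apply, coeffTriple_monomial_of_degree_ne hs,
        coeffTriple_monomial_of_degree_ne (by lia), sub_zero]⟩
  have hrep : ∀ a b c, triple e a b c ∉ U → ∃ g, ∀ h,
      (coeffTriple k e A E T - coeffTriple k e P 0 F) (g * h) = coeffTriple k e a b c h := by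
    intro a b c habc
    have hab := mt (hU a b c).mpr habc
    push Not at hab
    obtain ⟨h1, h2, h3⟩ := hab
    by_cases hc : c ≤ T
    · have hb : b < B + n := by
        by_contra hb
        exact h3 (by lia) (mem_of_triple_le hB (by lia) (by lia) (by lia))
      refine ⟨monomialTriple k e (A - a) (E - b) (T - c), fun h => ?_⟩
      rw [LinearMap.sub_apply, coeffTriple_monomialTriple_mul, coeffTriple_monomialTriple_mul,
        if_pos (by lia), if_neg (by lia), sub_zero]
      congr 2 <;> lia
    · obtain ⟨h4, h5, h6⟩ := h2 (by lia)
      refine ⟨-monomialTriple k e (P - a) 0 (F - c), fun h => ?_⟩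
      rw [neg_mul, map_neg, LinearMap.sub_apply, coeffTriple_monomialTriple_mul,
        coeffTriple_monomialTriple_mul, if_neg (by lia), if_pos (by lia), zero_sub, neg_neg]
      congr 2 <;> lia
  have hG : ∀ a b c, A < a ∨ T < c ∧ (P < a ∨ 0 < b) → monomialTriple k e a b c ∈
      functionalIdeal (coeffTriple k e A E T - coeffTriple k e P 0 F) := by
    intro a b c habc
    refine (mem_functionalIdeal_iff_monomialTriple e).mpr fun a' b' c' => ?_
    rw [monomialTriple_mul_monomialTriple, LinearMap.sub_apply, coeffTriple_monomialTriple,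
      coeffTriple_monomialTriple, if_neg (by lia), if_neg (by lia), sub_zero]
  refine isDoublyGLinked_triple e hφ hf hU0 hV hrep (fun a b c habc => ?_) (fun a b c habc => ?_)
    (fun a b c habc => ?_) ⟨0, B, 0, hB, monomialTriple k e A (E - B - n) T, ?_⟩
  · have hAa : a ≤ A := by
      by_contra h
      exact habc (mem_of_triple_le hA (by lia) (by lia) (by lia))
    by_cases hc : c ≤ T
    · obtain ⟨g, hg⟩ := hrep a (b + n) c fun h => by
        rcases (hU _ _ _).mp h with h | h | h
        · lia
        · lia
        · exact habc (by simpa using h.2)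
      refine ⟨g, fun h => ?_⟩
      rw [hg, add_mul, map_add, coeffTriple_monomialTriple_mul, coeffTriple_monomialTriple_mul,
        if_pos (by lia), if_neg (by lia), add_zero]
      simp
    · have hPa : a ≤ P := by
        by_contra h
        exact habc (mem_of_triple_le hxz (by lia) (by lia) (by lia))
      have hb : b = 0 := by
        by_contra h
        exact habc (mem_of_triple_le hyz (by lia) (by lia) (by lia))
      have hc : c < C := by
        by_contra h
        exact habc (mem_of_triple_le hC (by lia) (by lia) (by lia))
      obtain ⟨g, hg⟩ := hrep a b (c + n) fun h => by
        rcases (hU _ _ _).mp h with h | h | h <;> lia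
      refine ⟨g, fun h => ?_⟩
      rw [hg, add_mul, map_add, coeffTriple_monomialTriple_mul, coeffTriple_monomialTriple_mul,
        if_neg (by lia), if_pos (by lia), zero_add]
      simp
  · by_cases h1 : A < a ∨ T < c ∧ (P < a ∨ 0 < b)
    · exact Ideal.mem_sup_left (hG a b c h1)
    · by_cases h2 : C + n ≤ c
      · have hV' : triple e a b (c - n) ∈ V :=
          mem_of_triple_le hC (by lia) (by lia) (by lia)
        -- The y^n term of the product has a factor y and, as C > T, more than T factors z, so it
        -- lies in G.
        have heq : monomialTriple k e a b c =
            -monomialTriple k e a (b + n) (c - n) +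
            (monomialTriple k e 0 n 0 + monomialTriple k e 0 0 n) *
              monomialTriple k e a b (c - n) := by
          rw [add_mul, monomialTriple_mul_monomialTriple, monomialTriple_mul_monomialTriple,
            show n + (c - n) = c by lia, add_comm n b]
          simp only [zero_add]
          ring
        rw [heq]
        exact Submodule.add_mem_sup (neg_mem (hG _ _ _ (by lia)))
          (Ideal.mem_span_singleton_mul.mpr ⟨_, monomialTriple_mem_monomialIdeal.mpr hV', rfl⟩)
      · obtain ⟨hb, hV'⟩ : n ≤ b ∧ triple e a (b - n) c ∈ V := by
          rcases (hU _ _ _).mp habc with h | h | h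
          · lia
          · lia
          · exact h
        by_cases hc : T < c
        · exact absurd (Or.inr ⟨hc, Or.inr (by lia)⟩) h1
        -- Now the z^n term lies in G: as c ≤ T < C, `hVle` gives P < a or 0 < b - n, and c + n > T.
        have heq : monomialTriple k e a b c =
            -monomialTriple k e a (b - n) (c + n) +
            (monomialTriple k e 0 n 0 + monomialTriple k e 0 0 n) *
              monomialTriple k e a (b - n) c := by
          rw [add_mul, monomialTriple_mul_monomialTriple, monomialTriple_mul_monomialTriple,
            show n + (b - n) = b by lia, add_comm n c]
          simp only [zero_add]
          ring
        rw [heq]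
        have := hVle _ _ _ hV'
        exact Submodule.add_mem_sup (neg_mem (hG _ _ _ (by lia)))
          (Ideal.mem_span_singleton_mul.mpr ⟨_, monomialTriple_mem_monomialIdeal.mpr hV', rfl⟩)
  · rw [add_mul, monomialTriple_mul_monomialTriple, monomialTriple_mul_monomialTriple]
    refine add_mem ?_ ?_
    · rw [monomialTriple_mem_monomialIdeal, hU]
      exact Or.inr (Or.inr ⟨by lia, by simpa using habc⟩)
    · rw [monomialTriple_mem_monomialIdeal, hU]
      have := hVle _ _ _ habc
      exact Or.inr (Or.inl ⟨by lia, by lia⟩)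
  · rw [add_mul, monomialTriple_mul_monomialTriple, monomialTriple_mul_monomialTriple, mul_add,
      monomialTriple_mul_monomialTriple, monomialTriple_mul_monomialTriple, LinearMap.sub_apply,
      map_add, map_add]
    simp only [coeffTriple_monomialTriple]
    rw [if_pos (by lia), if_neg (by lia), if_neg (by lia), if_neg (by lia)]
    simp

/-- Dividing by `y` when the exponents in `U` without `y` are generated by `x ^ (A + 1)`,
`x ^ (P + 1) * z ^ (T + 1)` and a large power of `z`. -/
theorem isDoublyGLinked_lower {U V : UpperSet (Fin 3 →₀ ℕ)} {A B P T W N : ℕ}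
    (hU : ∀ a b c, triple e a b c ∈ U ↔
      A < a ∨ (P < a ∧ T < c) ∨ T + 1 + N ≤ c ∨ 1 ≤ b ∧ triple e a (b - 1) c ∈ V)
    (hV : (0 : Fin 3 →₀ ℕ) ∉ V) (hA : triple e (A + 1) 0 0 ∈ V) (hB : triple e 0 B 0 ∈ V)
    (hxz : triple e (P + 1) 0 (T + 1) ∈ V) (hz : triple e 0 0 (T + 1 + N) ∈ V)
    (hyz : triple e 0 W (T + 1) ∈ V) (hPA : P ≤ A) (hN : 2 * T + 2 ≤ N)
    (hWN : W + A + T + 3 ≤ N) (hBN : B + A + T + 3 ≤ 2 * N) :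
    IsDoublyGLinked (monomialIdeal k U) (monomialIdeal k V) := by
  obtain ⟨E, hE⟩ : ∃ E, A + E + T = P + 3 * N - 2 := ⟨P + 3 * N - 2 - A - T, by lia⟩
  -- The last two terms are killed by y^N + z^N, so G contains z^(T+1) (y^N + z^N). Modulo G,
  -- z^(T+1+N) is therefore -y^N z^(T+1), which lies in yV.
  obtain ⟨φ, hφ⟩ : ∃ φ, φ = coeffTriple k e A E T + coeffTriple k e P (2 * N - 1) (N - 1) -
    coeffTriple k e P (N - 1) (2 * N - 1) := ⟨_, rfl⟩
  have hU0 : (0 : Fin 3 →₀ ℕ) ∉ U := by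
    rw [← triple_zero (e := e), hU]
    lia
  have hφhom : IsHomogeneousFunctional φ := by
    refine ⟨A + E + T, fun s hs => ?_⟩
    rw [hφ, LinearMap.sub_apply, LinearMap.add_apply, coeffTriple_monomial_of_degree_ne hs,
        coeffTriple_monomial_of_degree_ne (by lia), coeffTriple_monomial_of_degree_ne (by lia),
        add_zero, sub_zero]
  have hrep₁ : ∀ a b c, a ≤ A → b + N ≤ E → c ≤ T →
      ∃ g, ∀ h, φ (g * h) = coeffTriple k e a b c h := by
    intro a b c ha hb hc
    -- The first monomial may also meet the second term of `φ`; trading y^N for z^N gives a monomial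
    -- that meets only the third term and cancels this.
    refine ⟨monomialTriple k e (A - a) (E - b) (T - c) +
      monomialTriple k e (A - a) (E - N - b) (T - c + N), fun h => ?_⟩
    rw [add_mul, map_add, hφ]
    simp only [LinearMap.sub_apply, LinearMap.add_apply, coeffTriple_monomialTriple_mul]
    rw [if_pos (show A - a ≤ A ∧ E - b ≤ E ∧ T - c ≤ T by lia),
      if_neg (show ¬ (A - a ≤ P ∧ E - b ≤ N - 1 ∧ T - c ≤ 2 * N - 1) by lia),
      if_neg (show ¬ (A - a ≤ A ∧ E - N - b ≤ E ∧ T - c + N ≤ T) by lia),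
      if_neg (show ¬ (A - a ≤ P ∧ E - N - b ≤ 2 * N - 1 ∧ T - c + N ≤ N - 1) by lia),
      show A - (A - a) = a by lia, show E - (E - b) = b by lia, show T - (T - c) = c by lia]
    by_cases hh : A - a ≤ P ∧ E - b ≤ 2 * N - 1
    · rw [if_pos (by lia), if_pos (by lia),
        show N - 1 - (E - N - b) = 2 * N - 1 - (E - b) by lia,
        show 2 * N - 1 - (T - c + N) = N - 1 - (T - c) by lia]
      ring
    · rw [if_neg (by lia), if_neg (by lia)]
      ring
  have hrep₂ : ∀ a b c, a ≤ P → b ≤ W → T < c → c < T + 1 + N →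
      ∃ g, ∀ h, φ (g * h) = coeffTriple k e a b c h := by
    intro a b c ha hb hc hc'
    -- For c ≥ N the complementary monomial also reads the coefficient at (a, b + N, c - N), which
    -- `hrep₁` can subtract.
    by_cases hNc : N ≤ c
    · obtain ⟨g, hg⟩ := hrep₁ a (b + N) (c - N) (by lia) (by lia) (by lia)
      refine ⟨-monomialTriple k e (P - a) (N - 1 - b) (2 * N - 1 - c) + g, fun h => ?_⟩
      rw [add_mul, map_add, hg, neg_mul, map_neg, hφ]
      simp only [LinearMap.sub_apply, LinearMap.add_apply, coeffTriple_monomialTriple_mul]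
      rw [if_neg (by lia), if_pos (by lia), if_pos (by lia), show P - (P - a) = a by lia,
        show 2 * N - 1 - (N - 1 - b) = b + N by lia,
        show N - 1 - (2 * N - 1 - c) = c - N by lia, show N - 1 - (N - 1 - b) = b by lia,
        show 2 * N - 1 - (2 * N - 1 - c) = c by lia]
      ring
    · refine ⟨-monomialTriple k e (P - a) (N - 1 - b) (2 * N - 1 - c), fun h => ?_⟩
      rw [neg_mul, map_neg, hφ]
      simp only [LinearMap.sub_apply, LinearMap.add_apply, coeffTriple_monomialTriple_mul]
      rw [if_neg (by lia), if_neg (by lia), if_pos (by lia), show P - (P - a) = a by lia,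
        show N - 1 - (N - 1 - b) = b by lia, show 2 * N - 1 - (2 * N - 1 - c) = c by lia]
      ring
  have hrep : ∀ a b c, triple e a b c ∉ U → ∃ g, ∀ h, φ (g * h) = coeffTriple k e a b c h := by
    intro a b c habc
    have hab := mt (hU a b c).mpr habc
    push Not at hab
    obtain ⟨h1, h2, h3, h4⟩ := hab
    by_cases hc : c ≤ T
    · have hb : b ≤ B := by
        by_contra hb
        exact h4 (by lia) (mem_of_triple_le hB (by lia) (by lia) (by lia))
      exact hrep₁ a b c h1 (by lia) hc
    · have hb : b ≤ W := by
        by_contra hb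
        exact h4 (by lia) (mem_of_triple_le hyz (by lia) (by lia) (by lia))
      exact hrep₂ a b c (by lia) hb (by lia) h3
  refine isDoublyGLinked_triple e hφhom
    (isHomogeneous_monomialTriple (a := 0) (b := 1) (c := 0) (e := e)) hU0 hV hrep
    (fun a b c habc => ?_) (fun a b c habc => ?_)
    (fun a b c habc => ?_) ⟨0, B, 0, hB, monomialTriple k e A (E - B - 1) T, ?_⟩
  · obtain ⟨g, hg⟩ := hrep a (b + 1) c fun h => by
      rcases (hU _ _ _).mp h with h | h | h | h
      · exact habc (mem_of_triple_le hA (by lia) (by lia) (by lia))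
      · exact habc (mem_of_triple_le hxz (by lia) (by lia) (by lia))
      · exact habc (mem_of_triple_le hz (by lia) (by lia) (by lia))
      · exact habc (by simpa using h.2)
    exact ⟨g, fun h => by rw [hg]; simp⟩
  · by_cases h1 : A < a ∨ P < a ∧ T < c
    · refine Ideal.mem_sup_left ((mem_functionalIdeal_iff_monomialTriple e).mpr fun a' b' c' => ?_)
      rw [monomialTriple_mul_monomialTriple, hφ]
      simp only [LinearMap.sub_apply, LinearMap.add_apply, coeffTriple_monomialTriple]
      rw [if_neg (by lia), if_neg (by lia), if_neg (by lia), add_zero, sub_zero]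
    · by_cases h2 : T + 1 + N ≤ c
      · have hV' : triple e a (b + N - 1) (c - N) ∈ V :=
          mem_of_triple_le hyz (by lia) (by lia) (by lia)
        have heq : monomialTriple k e a b c =
            (monomialTriple k e a (b + N) (c - N) + monomialTriple k e a b c) +
            monomialTriple k e 0 1 0 * -monomialTriple k e a (b + N - 1) (c - N) := by
          rw [mul_neg, monomialTriple_mul_monomialTriple, show 1 + (b + N - 1) = b + N by lia]
          simp only [zero_add]
          ring
        rw [heq]
        refine Submodule.add_mem_sup
          ((mem_functionalIdeal_iff_monomialTriple e).mpr fun a' b' c' => ?_)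
          (Ideal.mem_span_singleton_mul.mpr
            ⟨_, neg_mem (monomialTriple_mem_monomialIdeal.mpr hV'), rfl⟩)
        rw [mul_add, monomialTriple_mul_monomialTriple, monomialTriple_mul_monomialTriple, hφ,
          map_add]
        simp only [LinearMap.sub_apply, LinearMap.add_apply, coeffTriple_monomialTriple]
        rw [if_neg (show ¬ (a' + a = A ∧ b' + (b + N) = E ∧ c' + (c - N) = T) by lia),
          if_neg (show ¬ (a' + a = P ∧ b' + (b + N) = N - 1 ∧ c' + (c - N) = 2 * N - 1) by lia),
          if_neg (show ¬ (a' + a = A ∧ b' + b = E ∧ c' + c = T) by lia),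
          if_neg (show ¬ (a' + a = P ∧ b' + b = 2 * N - 1 ∧ c' + c = N - 1) by lia)]
        by_cases hh : a' + a = P ∧ b' + b = N - 1 ∧ c' + c = 2 * N - 1
        · rw [if_pos (by lia), if_pos (by lia)]
          ring
        · rw [if_neg (by lia), if_neg (by lia)]
          ring
      · obtain ⟨hb, hV'⟩ : 1 ≤ b ∧ triple e a (b - 1) c ∈ V := by
          have := (hU _ _ _).mp habc
          tauto
        refine Ideal.mem_sup_right (Ideal.mem_span_singleton_mul.mpr
          ⟨_, monomialTriple_mem_monomialIdeal.mpr hV', ?_⟩)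
        rw [monomialTriple_mul_monomialTriple]
        congr 1 <;> lia
  · rw [monomialTriple_mul_monomialTriple, monomialTriple_mem_monomialIdeal, hU]
    exact Or.inr (Or.inr (Or.inr ⟨by lia, by simpa using habc⟩))
  · rw [monomialTriple_mul_monomialTriple, monomialTriple_mul_monomialTriple, hφ]
    simp only [LinearMap.sub_apply, LinearMap.add_apply, coeffTriple_monomialTriple]
    rw [if_pos (by lia), if_neg (by lia), if_neg (by lia)]
    simp

end

/-! ### Chains of double links, complete intersections, and division by a variable -/

section

section

variable {σ k : Type*} [Field k]

theorem isMaximal_idealOfVars : (idealOfVars σ k).IsMaximal := by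
  have h : idealOfVars σ k = RingHom.ker (constantCoeff : MvPolynomial σ k →+* k) := by
    ext h
    rw [← pow_one (idealOfVars σ k), mem_pow_idealOfVars_iff', RingHom.mem_ker,
      constantCoeff_eq]
    refine ⟨fun hh => hh 0 (by simp), fun hh s hs => ?_⟩
    obtain rfl : s = 0 := (Finsupp.degree_eq_zero_iff s).mp (by lia)
    exact hh
  rw [h]
  exact RingHom.ker_isMaximal_of_surjective _ fun c => ⟨C c, constantCoeff_C _ c⟩

theorem isMPrimary_monomialIdeal {U : UpperSet (σ →₀ ℕ)} (hU : (0 : σ →₀ ℕ) ∉ U)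
    (hpow : ∀ i, ∃ n, Finsupp.single i n ∈ U) : IsMPrimary (monomialIdeal k U) := by
  have hmax := isMaximal_idealOfVars (σ := σ) (k := k)
  have hrad : (monomialIdeal k U).radical = idealOfVars σ k := by
    refine le_antisymm (hmax.isPrime.radical_le_iff.mpr fun h hh => ?_) (Ideal.span_le.mpr ?_)
    · rw [← pow_one (idealOfVars σ k), mem_pow_idealOfVars_iff]
      intro s hs
      rw [Nat.one_le_iff_ne_zero, Ne, Finsupp.degree_eq_zero_iff]
      rintro rfl
      exact hU (mem_monomialIdeal.mp hh 0 hs)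
    · rintro _ ⟨i, rfl⟩
      obtain ⟨n, hn⟩ := hpow i
      refine ⟨n, ?_⟩
      rw [X_pow_eq_monomial]
      exact monomial_mem_monomialIdeal.mpr hn
  exact ⟨Ideal.isPrimary_of_isMaximal_radical (hrad ▸ hmax), hrad⟩

/-- `I` reaches a complete intersection through double links between monomial ideals primary to the
ideal of the variables. -/
def IsMonomiallyGlicci (I : Ideal (MvPolynomial σ k)) : Prop :=
  ∃ (r : ℕ) (J : ℕ → Ideal (MvPolynomial σ k)), IsGLinkSequenceToCI I (2 * r) J ∧
    ∀ j ≤ r, IsMPrimary (J (2 * j)) ∧ IsMonomialIdeal (J (2 * j))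

theorem IsMonomiallyGlicci.of_isDoublyGLinked {I K : Ideal (MvPolynomial σ k)}
    (hK : IsMonomiallyGlicci K) (hIK : IsDoublyGLinked I K) (hI : IsMPrimary I)
    (hI' : IsMonomialIdeal I) : IsMonomiallyGlicci I := by
  obtain ⟨r, J, hJ, hJ'⟩ := hK
  obtain ⟨M, hM, hM'⟩ := hIK
  refine ⟨r + 1, fun n => match n with
    | 0 => I
    | 1 => M
    | n + 2 => J n, ⟨rfl, ?_, hJ.last_homogeneous, hJ.last_completeIntersection⟩, ?_⟩
  · rintro (_ | _ | n) hn
    · exact hM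
    · simpa [hJ.start] using hM'
    · exact hJ.link n (by lia)
  · rintro (_ | j) hj
    · exact ⟨hI, hI'⟩
    · exact hJ' j (by lia)

theorem IsMonomiallyGlicci.of_isCompleteIntersectionIdeal {I : Ideal (MvPolynomial σ k)}
    (hI : IsMPrimary I) (hI' : IsMonomialIdeal I) (hhom : IsHomogeneousIdeal I)
    (hci : IsCompleteIntersectionIdeal I) : IsMonomiallyGlicci I :=
  ⟨0, fun _ => I, ⟨rfl, fun i hi => absurd hi (by lia), hhom, hci⟩, fun _ _ => ⟨hI, hI'⟩⟩

theorem IsMonomiallyGlicci.isHomogeneouslyGlicci {I : Ideal (MvPolynomial σ k)}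
    (hI : IsMonomiallyGlicci I) : IsHomogeneouslyGlicci I :=
  let ⟨r, J, hJ, _⟩ := hI
  ⟨2 * r, J, hJ⟩

theorem monomialIdeal_upperClosure (S : Set (σ →₀ ℕ)) :
    monomialIdeal k (upperClosure S) = Ideal.span ((fun s => monomial s (1 : k)) '' S) := by
  ext h
  rw [mem_ideal_span_monomial_image, mem_monomialIdeal]
  rfl

/-- Multiplication by a monomial translates the support, so regularity modulo a monomial ideal can
be tested on exponents. -/
theorem mem_monomialIdeal_of_monomial_mul_mem {U : UpperSet (σ →₀ ℕ)} {t : σ →₀ ℕ}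
    (ht : ∀ s, t + s ∈ U → s ∈ U) {h : MvPolynomial σ k}
    (hh : monomial t 1 * h ∈ monomialIdeal k U) : h ∈ monomialIdeal k U := by
  refine mem_monomialIdeal.mpr fun s hs => ht s (mem_monomialIdeal.mp hh _ ?_)
  rw [mem_support_iff, coeff_monomial_mul, one_mul]
  exact mem_support_iff.mp hs

end

variable {k : Type*} [Field k] {e : Equiv.Perm (Fin 3)}

theorem isMPrimary_monomialIdeal_triple {U : UpperSet (Fin 3 →₀ ℕ)} {a b c : ℕ}
    (hU : (0 : Fin 3 →₀ ℕ) ∉ U) (ha : triple e a 0 0 ∈ U) (hb : triple e 0 b 0 ∈ U)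
    (hc : triple e 0 0 c ∈ U) : IsMPrimary (monomialIdeal k U) := by
  refine isMPrimary_monomialIdeal hU ((forall_fin_three_perm e).mpr ⟨⟨a, ?_⟩, ⟨b, ?_⟩, ⟨c, ?_⟩⟩)
  · simpa [triple] using ha
  · simpa [triple] using hb
  · simpa [triple] using hc

theorem IsMonomiallyGlicci.of_isDoublyGLinked_triple {U V : UpperSet (Fin 3 →₀ ℕ)} {a b c : ℕ}
    (hV : IsMonomiallyGlicci (monomialIdeal k V))
    (hUV : IsDoublyGLinked (monomialIdeal k U) (monomialIdeal k V))
    (hU : (0 : Fin 3 →₀ ℕ) ∉ U) (ha : triple e a 0 0 ∈ U) (hb : triple e 0 b 0 ∈ U)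
    (hc : triple e 0 0 c ∈ U) : IsMonomiallyGlicci (monomialIdeal k U) :=
  hV.of_isDoublyGLinked hUV (isMPrimary_monomialIdeal_triple hU ha hb hc)
    isMonomialIdeal_monomialIdeal

theorem exists_upperSet_triple (e : Equiv.Perm (Fin 3)) (p : ℕ → ℕ → ℕ → Prop)
    (hp : ∀ a b c a' b' c', a ≤ a' → b ≤ b' → c ≤ c' → p a b c → p a' b' c') :
    ∃ U : UpperSet (Fin 3 →₀ ℕ), ∀ a b c, triple e a b c ∈ U ↔ p a b c := by
  refine ⟨⟨{s | p (s (e 0)) (s (e 1)) (s (e 2))}, fun s t hst hs =>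
    hp _ _ _ _ _ _ (hst _) (hst _) (hst _) hs⟩, fun a b c => ?_⟩
  change p _ _ _ ↔ _
  simp

theorem isCompleteIntersectionIdeal_monomialIdeal {U : UpperSet (Fin 3 →₀ ℕ)} {A B C : ℕ}
    (hU : ∀ a b c, triple e a b c ∈ U ↔ A < a ∨ B < b ∨ C < c) :
    IsCompleteIntersectionIdeal (monomialIdeal k U) := by
  have hfst : Ideal.ofList [monomialTriple k e (A + 1) 0 0] =
      monomialIdeal k (upperClosure {triple e (A + 1) 0 0}) := by
    rw [Ideal.ofList_singleton, monomialIdeal_upperClosure, Set.image_singleton]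
    rfl
  have hsnd : Ideal.ofList [monomialTriple k e (A + 1) 0 0, monomialTriple k e 0 (B + 1) 0] =
      monomialIdeal k (upperClosure {triple e (A + 1) 0 0, triple e 0 (B + 1) 0}) := by
    rw [Ideal.ofList_cons, Ideal.ofList_singleton, monomialIdeal_upperClosure, Set.image_pair,
      Ideal.span_insert]
    rfl
  have hthd : Ideal.ofList [monomialTriple k e (A + 1) 0 0, monomialTriple k e 0 (B + 1) 0,
      monomialTriple k e 0 0 (C + 1)] = monomialIdeal k U := by
    have hUcl : U = upperClosure {triple e (A + 1) 0 0, triple e 0 (B + 1) 0,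
        triple e 0 0 (C + 1)} := by
      refine SetLike.ext ((forall_triple e).mpr fun a b c => ?_)
      rw [hU, mem_upperClosure]
      simp only [Set.mem_insert_iff, Set.mem_singleton_iff, exists_eq_or_imp, exists_eq_left,
        triple_le_triple]
      lia
    rw [hUcl, Ideal.ofList_cons, Ideal.ofList_cons, Ideal.ofList_singleton,
      monomialIdeal_upperClosure, Set.image_insert_eq, Set.image_pair, Ideal.span_insert,
      Ideal.span_insert]
    rfl
  refine ⟨_, ⟨⟨fun i hi => ?_⟩, ?_⟩, hthd.symm⟩
  · rw [isSMulRegular_quotient_iff_mem_of_smul_mem]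
    intro h
    rw [smul_eq_mul, Ideal.mul_top]
    match i with
    | 0 =>
      simp only [List.take_zero, Ideal.ofList_nil, List.getElem_cons_zero, smul_eq_mul,
        Ideal.mem_bot, mul_eq_zero]
      refine fun hh => hh.resolve_left ?_
      rw [monomialTriple, monomial_eq_zero]
      exact one_ne_zero
    | 1 =>
      simp only [List.take_succ_cons, List.take_zero, List.getElem_cons_succ,
        List.getElem_cons_zero, hfst, smul_eq_mul]
      refine mem_monomialIdeal_of_monomial_mul_mem ((forall_triple e).mpr fun a b c => ?_)
      simp
    | 2 =>
      simp only [List.take_succ_cons, List.take_zero, List.getElem_cons_succ,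
        List.getElem_cons_zero, hsnd, smul_eq_mul]
      refine mem_monomialIdeal_of_monomial_mul_mem ((forall_triple e).mpr fun a b c => ?_)
      simp [mem_upperClosure]
  · rw [hthd, smul_eq_mul, Ideal.mul_top]
    refine (monomialIdeal_ne_top_iff.mpr ?_).symm
    rw [← triple_zero (e := e), hU]
    lia

/-- If the exponents in `U` without `y` are generated by `x ^ (A + 1)`,
`x ^ (P + 1) * z ^ (T + 1)` and `z ^ (C + 1)`, then the ideal of `U` is connected with its colon
ideal by `y` through double links. -/
theorem IsMonomiallyGlicci.of_colon_variable {U V : UpperSet (Fin 3 →₀ ℕ)} {A B C P T : ℕ}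
    (hglicci : IsMonomiallyGlicci (monomialIdeal k V))
    (hU : ∀ a b c, triple e a b c ∈ U ↔
      A < a ∨ (P < a ∧ T < c) ∨ C < c ∨ 1 ≤ b ∧ triple e a (b - 1) c ∈ V)
    (hV : (0 : Fin 3 →₀ ℕ) ∉ V) (hA : triple e (A + 1) 0 0 ∈ V) (hB : triple e 0 B 0 ∈ V)
    (hC : triple e 0 0 (C + 1) ∈ V) (hxz : triple e (P + 1) 0 (T + 1) ∈ V)
    (hPA : P ≤ A) (hTC : T ≤ C) : IsMonomiallyGlicci (monomialIdeal k U) := by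
  -- Any `N` large enough for the numerical conditions of both links along y and of the link along
  -- y^N + z^N would do.
  obtain ⟨N, hN⟩ : ∃ N, N = A + B + 3 * C + 2 * T + 10 := ⟨_, rfl⟩
  obtain ⟨U₁, hU₁⟩ := exists_upperSet_triple e
    (fun a b c => A < a ∨ (P < a ∧ T < c) ∨ T + 1 + N ≤ c ∨ 1 ≤ b ∧ triple e a (b - 1) c ∈ V)
    fun a b c a' b' c' ha hb hc h => by
      rcases h with h | h | h | h
      · lia
      · lia
      · lia
      · exact Or.inr (Or.inr (Or.inr ⟨by lia, mem_of_triple_le h.2 ha (by lia) hc⟩))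
  obtain ⟨U₂, hU₂⟩ := exists_upperSet_triple e
    (fun a b c => A < a ∨ (C < c ∧ (P < a ∨ 0 < b ∨ T + 1 + N + N ≤ c)) ∨
      N ≤ b ∧ triple e a (b - N) c ∈ U₁)
    fun a b c a' b' c' ha hb hc h => by
      rcases h with h | h | h
      · lia
      · lia
      · exact Or.inr (Or.inr ⟨by lia, mem_of_triple_le h.2 ha (by lia) hc⟩)
  obtain ⟨U₃, hU₃⟩ := exists_upperSet_triple e
    (fun a b c => A < a ∨ C < c ∨ N - 1 ≤ b ∧ triple e a (b - (N - 1)) c ∈ U)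
    fun a b c a' b' c' ha hb hc h => by
      rcases h with h | h | h
      · lia
      · lia
      · exact Or.inr (Or.inr ⟨by lia, mem_of_triple_le h.2 ha (by lia) hc⟩)
  have hVB : triple e 0 (B + 1 - 1) 0 ∈ V := by simpa using hB
  have hU0 : (0 : Fin 3 →₀ ℕ) ∉ U := by
    rw [← triple_zero (e := e), hU]
    lia
  have hU₁0 : (0 : Fin 3 →₀ ℕ) ∉ U₁ := by
    rw [← triple_zero (e := e), hU₁]
    lia
  have hU₂0 : (0 : Fin 3 →₀ ℕ) ∉ U₂ := by
    rw [← triple_zero (e := e), hU₂]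
    lia
  have hU₃0 : (0 : Fin 3 →₀ ℕ) ∉ U₃ := by
    rw [← triple_zero (e := e), hU₃]
    lia
  have hUA : triple e (A + 1) 0 0 ∈ U := (hU _ _ _).mpr (by lia)
  have hUB : triple e 0 (B + 1) 0 ∈ U := (hU _ _ _).mpr (by simp [hB])
  have hUC : triple e 0 0 (C + 1) ∈ U := (hU _ _ _).mpr (by lia)
  have hU₁A : triple e (A + 1) 0 0 ∈ U₁ := (hU₁ _ _ _).mpr (by lia)
  have hU₁B : triple e 0 (B + 1) 0 ∈ U₁ := (hU₁ _ _ _).mpr (by simp [hB])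
  have hU₁C : triple e 0 0 (T + 1 + N) ∈ U₁ := (hU₁ _ _ _).mpr (by lia)
  have hU₁yz : triple e 0 1 (C + 1) ∈ U₁ := (hU₁ _ _ _).mpr (by simp [hC])
  have hU₂A : triple e (A + 1) 0 0 ∈ U₂ := (hU₂ _ _ _).mpr (by lia)
  have hU₂B : triple e 0 (B + 1 + N) 0 ∈ U₂ := (hU₂ _ _ _).mpr (by simp [hU₁B])
  have hU₂C : triple e 0 0 (T + 1 + N + N) ∈ U₂ := (hU₂ _ _ _).mpr (by lia)
  have hU₃A : triple e (A + 1) 0 0 ∈ U₃ := (hU₃ _ _ _).mpr (by lia)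
  have hU₃B : triple e 0 (B + 1 + (N - 1)) 0 ∈ U₃ := (hU₃ _ _ _).mpr (by simp [hUB])
  have hU₃C : triple e 0 0 (C + 1) ∈ U₃ := (hU₃ _ _ _).mpr (by lia)
  -- The two ideals differ only in z-degrees above C, which is what lets U₂ be compared with U₃.
  have hUU₁ : ∀ a b c, c ≤ C → (triple e a b c ∈ U ↔ triple e a b c ∈ U₁) := by
    intro a b c hc
    rw [hU, hU₁, or_iff_right (show ¬ C < c by lia), or_iff_right (show ¬ T + 1 + N ≤ c by lia)]
  have h₁ : IsDoublyGLinked (monomialIdeal k U₁) (monomialIdeal k V) :=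
    isDoublyGLinked_lower (W := B) hU₁ hV hA hB hxz
      (mem_of_triple_le hC (by lia) (by lia) (by lia))
      (mem_of_triple_le hB (by lia) (by lia) (by lia)) hPA (by lia) (by lia) (by lia)
  have h₂ : IsDoublyGLinked (monomialIdeal k U₂) (monomialIdeal k U₁) :=
    isDoublyGLinked_raise hU₂ hU₁0 hU₁A hU₁B hU₁C ((hU₁ _ _ _).mpr (by lia)) hU₁yz
      (fun a b c h => by
        rcases (hU₁ _ _ _).mp h with h | h | h | h <;> lia) hPA (by lia) (by lia)
  have h₃ : IsDoublyGLinked (monomialIdeal k U₂) (monomialIdeal k U₃) := by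
    -- With C in the role of T, this N makes the pure power of z exactly z^(T+1+2N), as in U₂; W = 0
    -- because z^(C+1) is already in U₃.
    refine isDoublyGLinked_lower (A := A) (P := P) (T := C) (W := 0) (N := T + N + N - C)
      (fun a b c => ?_) hU₃0 hU₃A hU₃B ((hU₃ _ _ _).mpr (by lia)) ((hU₃ _ _ _).mpr (by lia))
      hU₃C hPA (by lia) (by lia) (by lia)
    rw [hU₂, hU₃]
    by_cases hc : C < c
    · constructor
      · rintro (h | h | h) <;> lia
      · rintro (h | h | h | h) <;> lia
    · rw [show b - 1 - (N - 1) = b - N by lia, hUU₁ _ _ _ (by lia)]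
      constructor
      · rintro (h | h | h)
        · lia
        · lia
        · exact Or.inr (Or.inr (Or.inr ⟨by lia, Or.inr (Or.inr ⟨by lia, h.2⟩)⟩))
      · rintro (h | h | h | ⟨h, h' | h' | h'⟩)
        · lia
        · lia
        · lia
        · lia
        · lia
        · exact Or.inr (Or.inr ⟨by lia, h'.2⟩)
  have h₄ : IsDoublyGLinked (monomialIdeal k U₃) (monomialIdeal k U) :=
    isDoublyGLinked_shift hU₃ hU0 hUA hUB hUC
  exact (((hglicci.of_isDoublyGLinked_triple h₁ hU₁0 hU₁A hU₁B hU₁C).of_isDoublyGLinked_triple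
    h₂ hU₂0 hU₂A hU₂B hU₂C).of_isDoublyGLinked_triple
    h₃.symm hU₃0 hU₃A hU₃B hU₃C).of_isDoublyGLinked_triple h₄.symm hU0 hUA hUB hUC

end

/-! ### Counting mixed generators, and the induction -/

section

theorem single_eq_triple_zero (e : Equiv.Perm (Fin 3)) (n : ℕ) :
    Finsupp.single (e 0) n = triple e n 0 0 := by simp [triple]

theorem single_eq_triple_one (e : Equiv.Perm (Fin 3)) (n : ℕ) :
    Finsupp.single (e 1) n = triple e 0 n 0 := by simp [triple]

theorem single_eq_triple_two (e : Equiv.Perm (Fin 3)) (n : ℕ) :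
    Finsupp.single (e 2) n = triple e 0 0 n := by simp [triple]

section Antichain

variable {S : Finset (Fin 3 →₀ ℕ)} {q : Fin 3 → ℕ}

theorem exists_single_mem_of_mem_upperClosure (h0 : (0 : Fin 3 →₀ ℕ) ∉ S)
    (hpow : ∀ v, ∃ n, Finsupp.single v n ∈ upperClosure (S : Set (Fin 3 →₀ ℕ))) (v : Fin 3) :
    ∃ n, Finsupp.single v (n + 1) ∈ S := by
  obtain ⟨n, t, ht, htn⟩ := hpow v
  have htv : t = Finsupp.single v (t v) := by
    ext w
    by_cases hw : w = v
    · subst hw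
      simp
    · have := htn w
      rw [Finsupp.single_eq_of_ne hw] at this ⊢
      lia
  obtain ⟨m, hm⟩ : ∃ m, t v = m + 1 := by
    refine Nat.exists_eq_succ_of_ne_zero fun h => h0 ?_
    rw [h, Finsupp.single_zero] at htv
    exact htv ▸ ht
  exact ⟨m, hm ▸ htv ▸ ht⟩

/-- The elements of `S` other than the pure powers `single v (q v + 1)`. -/
noncomputable def mixedPart (S : Finset (Fin 3 →₀ ℕ)) (q : Fin 3 → ℕ) : Finset (Fin 3 →₀ ℕ) :=
  S \ Finset.univ.image fun v => Finsupp.single v (q v + 1)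

theorem mem_mixedPart {s : Fin 3 →₀ ℕ} :
    s ∈ mixedPart S q ↔ s ∈ S ∧ ∀ v, s ≠ Finsupp.single v (q v + 1) := by
  simp [mixedPart, eq_comm]

theorem card_mixedPart_add_three (hq : ∀ v, Finsupp.single v (q v + 1) ∈ S) :
    (mixedPart S q).card + 3 = S.card := by
  have hinj : Function.Injective fun v => Finsupp.single v (q v + 1) := fun v w h =>
    Finsupp.single_left_injective (b := q v + 1) (by lia) (by
      have hv : q v + 1 = q w + 1 := by
        rcases (Finsupp.single_eq_single_iff _ _ _ _).mp h with h | h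
        · exact h.2
        · lia
      simpa [hv] using h)
  have := Finset.card_sdiff_add_card_eq_card (s := Finset.univ.image
    fun v => Finsupp.single v (q v + 1)) (t := S) (by simpa [Finset.image_subset_iff] using hq)
  rwa [Finset.card_image_of_injective _ hinj, Finset.card_univ, Fintype.card_fin] at this

variable (hS : ∀ s ∈ S, ∀ t ∈ S, s ≤ t → s = t) (hq : ∀ v, Finsupp.single v (q v + 1) ∈ S)

include hS hq

theorem eq_single_of_forall_ne {s : Fin 3 →₀ ℕ} (hs : s ∈ S) {v : Fin 3}
    (h : ∀ w, w ≠ v → s w = 0) : s = Finsupp.single v (q v + 1) := by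
  have hsv : s = Finsupp.single v (s v) := by
    ext w
    by_cases hw : w = v
    · subst hw
      simp
    · rw [Finsupp.single_eq_of_ne hw, h w hw]
  rcases le_total (s v) (q v + 1) with hle | hle
  · exact hS _ hs _ (hq v) (by rw [hsv]; simpa using hle)
  · exact (hS _ (hq v) _ hs (Finsupp.single_le_iff.mpr hle)).symm

theorem apply_le_of_mem_mixedPart {s : Fin 3 →₀ ℕ} (hs : s ∈ mixedPart S q) (v : Fin 3) :
    s v ≤ q v := by
  by_contra h
  refine (mem_mixedPart.mp hs).2 v (hS _ (hq v) _ (mem_mixedPart.mp hs).1 ?_).symm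
  rw [Finsupp.single_le_iff]
  lia

theorem ne_zero_or_ne_zero_of_mem_mixedPart {s : Fin 3 →₀ ℕ} (hs : s ∈ mixedPart S q)
    {v w : Fin 3} (hvw : v ≠ w) : s v ≠ 0 ∨ s w ≠ 0 := by
  by_contra! h
  have key : ∀ v w : Fin 3, v ≠ w → ∃ u : Fin 3, ∀ i, i ≠ u → i = v ∨ i = w := by decide
  obtain ⟨u, hu⟩ := key v w hvw
  refine (mem_mixedPart.mp hs).2 u
    (eq_single_of_forall_ne hS hq (mem_mixedPart.mp hs).1 fun i hi => ?_)
  rcases hu i hi with rfl | rfl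
  · exact h.1
  · exact h.2

/-- A mixed generator omits at most one variable, so two for each variable would make six, but only
five are available. -/
theorem exists_card_filter_le_one (hcard : S.card ≤ 8) :
    ∃ v, ((mixedPart S q).filter fun s => s v = 0).card ≤ 1 := by
  by_contra! h
  have hdisj : ((Finset.univ : Finset (Fin 3)) : Set (Fin 3)).PairwiseDisjoint
      fun v => (mixedPart S q).filter fun s => s v = 0 := by
    intro v _ w _ hvw
    refine Finset.disjoint_left.mpr fun s hs hs' => ?_
    rw [Finset.mem_filter] at hs hs'
    rcases ne_zero_or_ne_zero_of_mem_mixedPart hS hq hs.1 hvw with h | h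
    · exact h hs.2
    · exact h hs'.2
  have hle : (Finset.univ.biUnion fun v => (mixedPart S q).filter fun s => s v = 0).card ≤
      (mixedPart S q).card :=
    Finset.card_le_card (Finset.biUnion_subset.mpr fun v _ => Finset.filter_subset _ _)
  rw [Finset.card_biUnion hdisj, Fin.sum_univ_three] at hle
  have := card_mixedPart_add_three hq
  have := h 0
  have := h 1
  have := h 2
  lia

/-- Either there are no mixed generators, or some variable can be divided out. -/
theorem mixedPart_eq_empty_or_exists (hcard : S.card ≤ 8) : mixedPart S q = ∅ ∨
    ∃ v, 1 ≤ q v ∧ ((mixedPart S q).filter fun s => s v = 0).card ≤ 1 := by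
  obtain ⟨v, hv⟩ := exists_card_filter_le_one hS hq hcard
  -- If the variable itself is a generator, all mixed generators omit it, so there is at most one; a
  -- variable other than `v` then divides it and can be used.
  by_cases hqv : 1 ≤ q v
  · exact Or.inr ⟨v, hqv, hv⟩
  have hzero : ∀ s ∈ mixedPart S q, s v = 0 := fun s hs => by
    have := apply_le_of_mem_mixedPart hS hq hs v
    lia
  rcases (mixedPart S q).eq_empty_or_nonempty with h | ⟨m, hm⟩
  · exact Or.inl h
  obtain ⟨w, hw⟩ := exists_ne v
  rw [Finset.filter_true_of_mem hzero] at hv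
  have hmw : m w ≠ 0 := (ne_zero_or_ne_zero_of_mem_mixedPart hS hq hm hw).resolve_right
    (not_not.mpr (hzero m hm))
  refine Or.inr ⟨w, ?_, (Finset.card_le_card (Finset.filter_subset _ _)).trans hv⟩
  have := apply_le_of_mem_mixedPart hS hq hm w
  lia

end Antichain

variable {k : Type*} [Field k]

/-- Induction on the sum of degrees over possibly redundant generating sets: dividing by a variable
keeps the cardinality bound but may create redundancy, which erasing removes. -/
theorem isMonomiallyGlicci_upperClosure (S : Finset (Fin 3 →₀ ℕ)) (hcard : S.card ≤ 8)
    (h0 : (0 : Fin 3 →₀ ℕ) ∉ S)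
    (hpow : ∀ v, ∃ n, Finsupp.single v n ∈ upperClosure (S : Set (Fin 3 →₀ ℕ))) :
    IsMonomiallyGlicci (monomialIdeal k (upperClosure (S : Set (Fin 3 →₀ ℕ)))) := by
  induction hN : ∑ s ∈ S, s.degree using Nat.strong_induction_on generalizing S with
  | _ N ih =>
  subst hN
  by_cases hanti : ∃ s ∈ S, ∃ t ∈ S, s ≤ t ∧ s ≠ t
  · obtain ⟨s, hs, t, ht, hst, hne⟩ := hanti
    have hcl : upperClosure (S : Set (Fin 3 →₀ ℕ)) = upperClosure (S.erase t : Set _) := by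
      refine SetLike.ext fun x => ⟨?_, ?_⟩
      · rintro ⟨u, hu, hux⟩
        by_cases hut : u = t
        · exact ⟨s, Finset.mem_coe.mpr (Finset.mem_erase.mpr ⟨hne, hs⟩), hst.trans (hut ▸ hux)⟩
        · exact ⟨u, Finset.mem_coe.mpr (Finset.mem_erase.mpr ⟨hut, hu⟩), hux⟩
      · rintro ⟨u, hu, hux⟩
        exact ⟨u, Finset.mem_coe.mpr (Finset.mem_of_mem_erase hu), hux⟩
    rw [hcl]
    refine ih _ ?_ (S.erase t) ((Finset.card_erase_le).trans hcard)
      (fun h => h0 (Finset.mem_of_mem_erase h)) (hcl ▸ hpow) rfl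
    rw [← Finset.sum_erase_add _ _ ht, Nat.lt_add_right_iff_pos, pos_iff_ne_zero, Ne,
      Finsupp.degree_eq_zero_iff]
    exact fun h => h0 (h ▸ ht)
  push Not at hanti
  choose q hq using exists_single_mem_of_mem_upperClosure h0 hpow
  have h0' : (0 : Fin 3 →₀ ℕ) ∉ upperClosure (S : Set (Fin 3 →₀ ℕ)) := by
    rintro ⟨s, hs, hs0⟩
    exact h0 (nonpos_iff_eq_zero.mp hs0 ▸ hs)
  rcases mixedPart_eq_empty_or_exists hanti hq hcard with hM | ⟨v, hqv, hv⟩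
  · refine .of_isCompleteIntersectionIdeal (isMPrimary_monomialIdeal h0' hpow)
      isMonomialIdeal_monomialIdeal isHomogeneousIdeal_monomialIdeal
      (isCompleteIntersectionIdeal_monomialIdeal (e := 1) (A := q 0) (B := q 1) (C := q 2)
        fun a b c => ?_)
    have hmem : ∀ s ∈ S, ∃ v, s = Finsupp.single v (q v + 1) := by
      intro s hs
      by_contra! h
      exact Finset.notMem_empty s (hM ▸ mem_mixedPart.mpr ⟨hs, h⟩)
    rw [mem_upperClosure]
    have h1 := single_eq_triple_zero 1
    have h2 := single_eq_triple_one 1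
    have h3 := single_eq_triple_two 1
    simp only [Equiv.Perm.coe_one, id_eq] at h1 h2 h3
    constructor
    · rintro ⟨s, hs, hle⟩
      obtain ⟨v, rfl⟩ := hmem s hs
      fin_cases v
      · exact Or.inl (by simpa [h1, Nat.succ_le_iff] using hle)
      · exact Or.inr (Or.inl (by simpa [h2, Nat.succ_le_iff] using hle))
      · exact Or.inr (Or.inr (by simpa [h3, Nat.succ_le_iff] using hle))
    · rintro (h | h | h)
      · exact ⟨_, hq 0, by simpa [h1, Nat.succ_le_iff] using h⟩
      · exact ⟨_, hq 1, by simpa [h2, Nat.succ_le_iff] using h⟩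
      · exact ⟨_, hq 2, by simpa [h3, Nat.succ_le_iff] using h⟩
  obtain ⟨e, rfl⟩ : ∃ e : Equiv.Perm (Fin 3), v = e 1 := ⟨Equiv.swap 1 v, by simp⟩
  have hsub : ∀ s : Fin 3 →₀ ℕ, s - Finsupp.single (e 1) 1 =
      triple e (s (e 0)) (s (e 1) - 1) (s (e 2)) := by
    intro s
    conv_lhs => rw [← triple_eta (e := e) s, single_eq_triple_one, triple_tsub]
    simp
  have hle : ∀ {s : Fin 3 →₀ ℕ} {a b c : ℕ},
      s ≤ triple e a b c ↔ s (e 0) ≤ a ∧ s (e 1) ≤ b ∧ s (e 2) ≤ c := by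
    intro s a b c
    conv_lhs => rw [← triple_eta (e := e) s]
    exact triple_le_triple
  obtain ⟨P, T, hP, hT, hPT, hzero⟩ : ∃ P T, P ≤ q (e 0) ∧ T ≤ q (e 2) ∧
      triple e (P + 1) 0 (T + 1) ∈ upperClosure (S : Set (Fin 3 →₀ ℕ)) ∧
      ∀ s ∈ S, s (e 1) = 0 →
        q (e 0) < s (e 0) ∨ (P < s (e 0) ∧ T < s (e 2)) ∨ q (e 2) < s (e 2) := by
    have hpure : ∀ s ∈ S, s (e 1) = 0 → s ∉ mixedPart S q →
        q (e 0) < s (e 0) ∨ q (e 2) < s (e 2) := by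
      intro s hs hs1 hsM
      obtain ⟨w, rfl⟩ : ∃ w, s = Finsupp.single w (q w + 1) := by
        by_contra! h
        exact hsM (mem_mixedPart.mpr ⟨hs, h⟩)
      obtain ⟨w, rfl⟩ := e.surjective w
      fin_cases w
      · exact Or.inl (by simp)
      · simp at hs1
      · exact Or.inr (by simp)
    rcases Finset.eq_empty_or_nonempty ((mixedPart S q).filter fun s => s (e 1) = 0) with
      hE | ⟨m, hm⟩
    -- Without a mixed generator free of y, a redundant multiple of the pure powers takes its place.
    · refine ⟨q (e 0), q (e 2), le_rfl, le_rfl, ⟨_, hq (e 0), ?_⟩, fun s hs hs1 => ?_⟩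
      · simp [single_eq_triple_zero]
      · have := hpure s hs hs1 fun h =>
          Finset.notMem_empty s (hE ▸ Finset.mem_filter.mpr ⟨h, hs1⟩)
        tauto
    · obtain ⟨hmM, hm1⟩ := Finset.mem_filter.mp hm
      have hm0 : m (e 0) ≠ 0 := (ne_zero_or_ne_zero_of_mem_mixedPart hanti hq hmM
        (v := e 0) (w := e 1) (by simp)).resolve_right (not_not.mpr hm1)
      have hm2 : m (e 2) ≠ 0 := (ne_zero_or_ne_zero_of_mem_mixedPart hanti hq hmM
        (v := e 2) (w := e 1) (by simp)).resolve_right (not_not.mpr hm1)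
      have hq0 := apply_le_of_mem_mixedPart hanti hq hmM (e 0)
      have hq2 := apply_le_of_mem_mixedPart hanti hq hmM (e 2)
      refine ⟨m (e 0) - 1, m (e 2) - 1, by lia, by lia,
        ⟨m, (mem_mixedPart.mp hmM).1, hle.mpr ⟨by lia, by lia, by lia⟩⟩, fun s hs hs1 => ?_⟩
      by_cases hsM : s ∈ mixedPart S q
      · obtain rfl : s = m := Finset.card_le_one.mp hv _ (Finset.mem_filter.mpr ⟨hsM, hs1⟩) _ hm
        lia
      · have := hpure s hs hs1 hsM
        tauto
  have hcolon : ∀ {x}, x ∈ upperClosure (S : Set (Fin 3 →₀ ℕ)) →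
      x ∈ upperClosure ((S.image (· - Finsupp.single (e 1) 1) : Finset _) : Set _) := by
    rintro x ⟨s, hs, hsx⟩
    exact ⟨_, Finset.mem_coe.mpr (Finset.mem_image_of_mem _ hs), tsub_le_self.trans hsx⟩
  -- Only the generator y could become 1, and `hqv` excludes it.
  have h0'' : (0 : Fin 3 →₀ ℕ) ∉ S.image (· - Finsupp.single (e 1) 1) := by
    intro h
    obtain ⟨s, hs, hs0⟩ := Finset.mem_image.mp h
    rw [hsub, ← triple_zero (e := e), triple_inj] at hs0
    have h1 := eq_single_of_forall_ne hanti hq hs (v := e 1) fun w hw => by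
      obtain ⟨w, rfl⟩ := e.surjective w
      fin_cases w
      · exact hs0.1
      · exact absurd rfl hw
      · exact hs0.2.2
    have h2 : s (e 1) = q (e 1) + 1 := by
      rw [h1]
      simp
    lia
  refine IsMonomiallyGlicci.of_colon_variable (e := e) (A := q (e 0)) (B := q (e 1) + 1)
    (C := q (e 2)) (P := P) (T := T)
    (ih _ ?_ (S.image (· - Finsupp.single (e 1) 1)) (Finset.card_image_le.trans hcard) h0''
      (fun w => (hpow w).imp fun n hn => hcolon hn) rfl)
    (fun a b c => ?_) ?_ ?_ ?_ ?_ (hcolon hPT) hP hT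
  · refine (Finset.sum_image_le_of_nonneg fun _ _ => Nat.zero_le _).trans_lt ?_
    refine Finset.sum_lt_sum (fun s _ => Finsupp.degree_mono tsub_le_self) ⟨_, hq (e 1), ?_⟩
    rw [← Finsupp.single_tsub, Finsupp.degree_single, Finsupp.degree_single]
    lia
  · constructor
    · rintro ⟨s, hs, hsle⟩
      have hsle' := hle.mp hsle
      by_cases hs1 : s (e 1) = 0
      · have := hzero s hs hs1
        lia
      · refine Or.inr (Or.inr (Or.inr ⟨by lia,
          ⟨_, Finset.mem_coe.mpr (Finset.mem_image_of_mem _ hs), ?_⟩⟩))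
        rw [hsub, triple_le_triple]
        lia
    · rintro (h | h | h | ⟨h, t, ht, htle⟩)
      · exact ⟨_, hq (e 0), by simp [single_eq_triple_zero]; lia⟩
      · exact mem_of_triple_le hPT (by lia) (by lia) (by lia)
      · exact ⟨_, hq (e 2), by simp [single_eq_triple_two]; lia⟩
      · obtain ⟨s, hs, rfl⟩ := Finset.mem_image.mp (Finset.mem_coe.mp ht)
        refine ⟨s, hs, hle.mpr ?_⟩
        rw [hsub, triple_le_triple] at htle
        lia
  · rintro ⟨s, hs, hs0⟩
    exact h0'' (nonpos_iff_eq_zero.mp hs0 ▸ hs)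
  · exact hcolon ⟨_, hq (e 0), by simp [single_eq_triple_zero]⟩
  · exact hcolon ⟨_, hq (e 1), by simp [single_eq_triple_one]⟩
  · exact hcolon ⟨_, hq (e 2), by simp [single_eq_triple_two]⟩

/-! ### Minimal exponents and the number of generators -/

section MinimalGenerators

variable {σ : Type*}

/-- No smaller exponent of `h` can contribute at `s`: the coefficient at `s` factors through the
ideal modulo the variables times it. -/
theorem coeff_mul_of_minimal {U : UpperSet (σ →₀ ℕ)} {s : σ →₀ ℕ} (hs : Minimal (· ∈ U) s)
    (r : MvPolynomial σ k) {h : MvPolynomial σ k} (hh : h ∈ monomialIdeal k U) :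
    coeff s (r * h) = coeff 0 r * coeff s h := by
  classical
  rw [coeff_mul, Finset.sum_eq_single (0, s)]
  · rintro ⟨a, b⟩ hab hne
    rw [Finset.HasAntidiagonal.mem_antidiagonal] at hab
    by_cases hb : coeff b h = 0
    · rw [hb, mul_zero]
    · have hbU : b ∈ U := hh (mem_support_iff.mpr hb)
      have hbs : b = s := hs.eq_of_le hbU (hab ▸ le_add_self)
      subst hbs
      simp at hab
      exact absurd (by rw [hab]) hne
  · simp

variable [Finite σ]

theorem exists_finset_upperClosure {U : UpperSet (σ →₀ ℕ)} {n : ℕ}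
    (hn : ∀ F : Finset (σ →₀ ℕ), (∀ s ∈ F, Minimal (· ∈ U) s) → F.card ≤ n) :
    ∃ S : Finset (σ →₀ ℕ), S.card ≤ n ∧ upperClosure (S : Set (σ →₀ ℕ)) = U := by
  have hfin : {s | Minimal (· ∈ U) s}.Finite := by
    by_contra hinf
    obtain ⟨F, hF, hcard⟩ := Set.Infinite.exists_subset_card_eq hinf (n + 1)
    have := hn F fun s hs => hF hs
    lia
  refine ⟨hfin.toFinset, hn _ fun s hs => by simpa using hs, SetLike.ext fun x => ⟨?_, fun hx => ?_⟩⟩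
  · rintro ⟨s, hs, hsx⟩
    have hs' : Minimal (· ∈ U) s := by simpa using hs
    exact U.upper hsx hs'.prop
  · obtain ⟨s, hsx, hs⟩ := exists_minimal_le_of_wellFoundedLT (· ∈ U) x hx
    exact ⟨s, by simpa using hs, hsx⟩

/-- Reading coefficients at `F` maps the ideal onto a space of dimension `F.card`, and by
`coeff_mul_of_minimal` the images of ideal generators span it over the field. -/
theorem card_le_spanFinrank {U : UpperSet (σ →₀ ℕ)} (F : Finset (σ →₀ ℕ))
    (hF : ∀ s ∈ F, Minimal (· ∈ U) s) : F.card ≤ (monomialIdeal k U).spanFinrank := by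
  classical
  obtain ⟨G, hG, hspan⟩ := Submodule.FG.exists_span_finset_card_eq_spanFinrank
    (IsNoetherian.noetherian (monomialIdeal k U))
  rw [← hG]
  let π : MvPolynomial σ k →ₗ[k] (F → k) := LinearMap.pi fun s => lcoeff k s.1
  have hπ : ∀ h s, π h s = coeff s.1 h := fun _ _ => rfl
  have hmem : ∀ h ∈ monomialIdeal k U, π h ∈ Submodule.span k (G.image π : Set (F → k)) := by
    intro h hh
    rw [← hspan] at hh
    induction hh using Submodule.span_induction with
    | mem x hx => exact Submodule.subset_span (Finset.mem_coe.mpr (Finset.mem_image_of_mem _ hx))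
    | zero => rw [map_zero]; exact zero_mem _
    | add x y _ _ hx hy => rw [map_add]; exact add_mem hx hy
    | smul r x hx hxs =>
      have : π (r • x) = coeff 0 r • π x := by
        ext s
        rw [hπ, smul_eq_mul, coeff_mul_of_minimal (hF s.1 s.2) r (hspan ▸ hx), Pi.smul_apply,
          smul_eq_mul, hπ]
      rw [this]
      exact Submodule.smul_mem _ _ hxs
  have htop : Submodule.span k (G.image π : Set (F → k)) = ⊤ := by
    rw [eq_top_iff, ← (Pi.basisFun k F).span_eq, Submodule.span_le]
    rintro _ ⟨s, rfl⟩
    have : Pi.basisFun k F s = π (monomial s.1 1) := by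
      ext t
      rw [hπ, coeff_monomial, Pi.basisFun_apply, Pi.single_apply]
      by_cases hst : t = s
      · simp [hst]
      · rw [if_neg hst, if_neg fun h => hst (Subtype.ext h.symm)]
    rw [this]
    exact hmem _ (monomial_mem_monomialIdeal.mpr (hF s.1 s.2).prop)
  have hle := finrank_span_finset_le_card (R := k) (G.image π)
  rw [Set.finrank, htop, finrank_top, Module.finrank_fintype_fun_eq_card, Fintype.card_coe] at hle
  exact hle.trans Finset.card_image_le

theorem IsMonomialIdeal.exists_finset {I : Ideal (MvPolynomial σ k)} (hI : IsMonomialIdeal I) :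
    ∃ S : Finset (σ →₀ ℕ), S.card ≤ I.spanFinrank ∧
      I = monomialIdeal k (upperClosure (S : Set (σ →₀ ℕ))) := by
  obtain ⟨S, rfl⟩ := hI
  rw [← monomialIdeal_upperClosure]
  obtain ⟨S', hS', hcl⟩ := exists_finset_upperClosure (U := upperClosure S)
    (card_le_spanFinrank (k := k))
  exact ⟨S', hS', by rw [hcl]⟩

end MinimalGenerators

end

end MvPolynomial

theorem lemma3p2 {k : Type*} [Field k] (I : Ideal (MvPolynomial (Fin 3) k))
    (hprimary : MvPolynomial.IsMPrimary I) (hmonomial : MvPolynomial.IsMonomialIdeal I)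
    (hgens : Submodule.spanFinrank I ≤ 7) :
    MvPolynomial.IsHomogeneouslyGlicci I ∧
      ∃ (r : ℕ) (J : ℕ → Ideal (MvPolynomial (Fin 3) k)),
        MvPolynomial.IsGLinkSequenceToCI I (2 * r) J ∧
          ∀ j ≤ r, MvPolynomial.IsMPrimary (J (2 * j)) ∧
            MvPolynomial.IsMonomialIdeal (J (2 * j)) := by
  obtain ⟨S, hcard, rfl⟩ := hmonomial.exists_finset
  have h0 : (0 : Fin 3 →₀ ℕ) ∉ S := fun h =>
    MvPolynomial.monomialIdeal_ne_top_iff.mp hprimary.1.1 ⟨0, h, le_rfl⟩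
  have hpow : ∀ v, ∃ n, Finsupp.single v n ∈ upperClosure (S : Set (Fin 3 →₀ ℕ)) := by
    intro v
    obtain ⟨n, hn⟩ : (MvPolynomial.X v : MvPolynomial (Fin 3) k) ∈
        (MvPolynomial.monomialIdeal k (upperClosure (S : Set (Fin 3 →₀ ℕ)))).radical := by
      rw [hprimary.2]
      exact Ideal.subset_span ⟨v, rfl⟩
    rw [MvPolynomial.X_pow_eq_monomial] at hn
    exact ⟨n, MvPolynomial.monomial_mem_monomialIdeal.mp hn⟩
  have h := MvPolynomial.isMonomiallyGlicci_upperClosure (k := k) S (by lia) h0 hpow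
  exact ⟨h.isHomogeneouslyGlicci, h⟩
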